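/- Let $\beta\in\mathbb{R}$ and work in the ring $\mathbb{R}[[x_1,x_2,x_3,\dots]]$ of formal power series. For finite sets $D\subseteq E$ of positions in $\mathbb{Z}_{>0}\times\mathbb{Z}_{>0}$ (row, column), let $\mathrm{Int}(D)$ be the set of $(i,j)\in D$ with $(i+1,j)\in D$ or $(i,j+1)\in D$. A set-valued tableau $T$ of shape $E/\!\!/D$ assigns to each $(i,j)\in E\setminus\mathrm{Int}(D)$ a finite set $T_{ij}\subset\frac12\mathbb{Z}_{>0}$, nonempty if $(i,j)\notin D$, such that (with $T_{ij}=\varnothing$ at all other positions) $\max T_{ij}\le\min T_{i,j+1}$ and $\max T_{ij}\le\min T_{i+1,j}$ whenever the two sets involved are nonempty. Put $|T|=\sum|T_{ij}|$ and $x^T=\prod_{(i,j)}\prod_{a\in T_{ij}}x_{\lceil a\rceil}$. For partitions $\mu\subseteq\lambda$ with diagrams $\mathsf{D}_\mu\subseteq\mathsf{D}_\lambda$, where $\mathsf{D}_\lambda=\{(i,j):1\le j\le\lambda_i\}$, let $G^{(\beta)}_{\lambda/\!\!/\mu}=\sum_T\beta^{|T|-|\lambda|+|\mu|}x^T$, the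 sum being over all set-valued tableaux $T$ of shape $\mathsf{D}_\lambda/\!\!/\mathsf{D}_\mu$ with integer entries and with $T_{ij}\cap T_{i+1,j}=\varnothing$ for all $i,j$. Let $G^{(\beta)}_\lambda=G^{(\beta)}_{\lambda/\!\!/\varnothing}$, and let $\Gamma^{(\beta)}$ be the $\mathbb{R}$-span of all $G^{(\beta)}_{\lambda/\!\!/\mu}$ with $\mu\subseteq\lambda$. For strict partitions $\mu\subseteq\lambda$ with shifted diagrams $\mathsf{SD}_\mu\subseteq\mathsf{SD}_\lambda$, where $\mathsf{SD}_\lambda=\{(i,i+j-1):(i,j)\in\mathsf{D}_\lambda\}$, let $GQ^{(\beta)}_{\lambda/\!\!/\mu}=\sum_T\beta^{|T|-|\lambda|+|\mu|}x^T$, the sum being over all set-valued tableaux $T$ of shape $\mathsf{SD}_\lambda/\!\!/\mathsf{SD}_\mu$ such that $T_{ij}\cap T_{i,j+1}$ contains only integers and $T_{ij}\cap T_{i+1,j}$ contains only non-integers, for all $i,j$. Let $GQ^{(\beta)}_{\lambda/\mu}$ be the same sum restricted to those $T$ with $T_{ij}=\varnothing$ for all $(i,j)\in\mathsf{SD}_\mu$.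 Let $\Gamma_Q^{(\beta)}$ be the $\mathbb{R}$-span of all $GQ^{(\beta)}_{\lambda/\!\!/\mu}$ with $\mu\subseteq\lambda$ strict. Then there are a unique linear map $\Omega^{(\beta)}:\Gamma^{(\beta)}\to\Gamma^{(\beta)}$ with $\Omega^{(\beta)}(G^{(\beta)}_\lambda)=G^{(\beta)}_{\lambda^\top}$ for all partitions $\lambda$, where $\lambda^\top$ is the transpose of $\lambda$, and a unique linear map $\Theta^{(\beta)}:\Gamma^{(\beta)}\to\Gamma_Q^{(\beta)}$ with $\Theta^{(\beta)}(G^{(\beta)}_\lambda)=GQ^{(\beta)}_{(\lambda+\delta)/\delta}$ for all partitions $\lambda$, where $\delta=(n,\dots,2,1)$ and $n$ is the number of nonzero parts of $\lambda$. These maps satisfy $$\Theta^{(\beta)}\circ\Omega^{(\beta)}=\Theta^{(\beta)}.$$ -/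

import Mathlib

namespace KSym

/-! Positions in diagrams are pairs `(i, j) : ℕ × ℕ`, numbered from `0` (as in Mathlib's
`YoungDiagram`): row `i`, column `j`. A partition is a `YoungDiagram`, and `μ ⊆ λ` is `μ ≤ λ`. -/

/-- The interior of `D`: the boxes of `D` with a box of `D` directly below or directly to the
right. -/
def interior (D : Finset (ℕ × ℕ)) : Finset (ℕ × ℕ) :=
  D.filter fun p => (p.1 + 1, p.2) ∈ D ∨ (p.1, p.2 + 1) ∈ D

/-- A filling of the boxes of the quadrant by finite sets of letters. -/
abbrev Filling (α : Type) : Type := ℕ × ℕ → Finset α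

/-- `A ⪯ B`: one of the sets is empty or `max A ≤ min B`. -/
def SetLE {α : Type} [LinearOrder α] (A B : Finset α) : Prop :=
  ∀ a ∈ A, ∀ b ∈ B, a ≤ b

/-- `T` is a set-valued tableau of shape `E // D`. The filling is extended by `∅` outside the set
`E ∖ interior D` of boxes that it really occupies. -/
structure IsSetValued {α : Type} [LinearOrder α] (E D : Finset (ℕ × ℕ)) (T : Filling α) :
    Prop where
  empty_outside : ∀ p, p ∉ E \ interior D → T p = ∅
  nonempty : ∀ p ∈ E \ D, (T p).Nonempty
  row_le : ∀ i j, SetLE (T (i, j)) (T (i, j + 1))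
  col_le : ∀ i j, SetLE (T (i, j)) (T (i + 1, j))

/-- `|T|`, the total number of entries of a filling supported on `E`. -/
def size {α : Type} (E : Finset (ℕ × ℕ)) (T : Filling α) : ℕ :=
  ∑ p ∈ E, (T p).card

/-- The exponent vector of the monomial `x^T`, where the letter `a` contributes the variable
`x_{idx a}`. -/
noncomputable def weight {α : Type} (idx : α → ℕ+) (E : Finset (ℕ × ℕ)) (T : Filling α) :
    ℕ+ →₀ ℕ :=
  ∑ p ∈ E, ∑ a ∈ T p, Finsupp.single (idx a) 1

/-- The formal power series `∑_{T ∈ S} β^(|T| - N) x^T` in the variables `x_1, x_2, …`, for a set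
`S` of fillings supported on `E`: the coefficient of `x^m` is the sum of `β^(|T| - N)` over the
`T ∈ S` with `x^T = x^m`. -/
noncomputable def tableauSeries {α : Type} (idx : α → ℕ+) (β : ℝ) (E : Finset (ℕ × ℕ)) (N : ℕ)
    (S : Set (Filling α)) : MvPowerSeries ℕ+ ℝ :=
  fun m => ∑ᶠ T ∈ {T : Filling α | T ∈ S ∧ weight idx E T = m}, β ^ (size E T - N)

/-- The sums in `tableauSeries` are finite: only finitely many set-valued tableaux of a given shape
have a given weight, when each variable belongs to finitely many letters. -/
theorem finite_weight_eq {α : Type} [LinearOrder α] (idx : α → ℕ+)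
    (hidx : ∀ n, (idx ⁻¹' {n}).Finite) (E D : Finset (ℕ × ℕ)) (m : ℕ+ →₀ ℕ) :
    {T : Filling α | IsSetValued E D T ∧ weight idx E T = m}.Finite := by
  classical
  have hA : (idx ⁻¹' (m.support : Set ℕ+)).Finite :=
    Set.Finite.preimage' m.support.finite_toSet fun n _ => hidx n
  let A : Finset α := hA.toFinset
  let f : Filling α → (E → Finset α) := fun T p => T p
  refine Set.Finite.of_finite_image (f := f)
    ((Set.Finite.pi' (t := fun _ : E => (A.powerset : Set (Finset α)))
      fun _ => Finset.finite_toSet _).subset ?_) ?_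
  · rintro _ ⟨T, ⟨hT, hw⟩, rfl⟩ p
    simp only [Finset.mem_coe, Finset.mem_powerset]
    intro a ha
    simp only [A, Set.Finite.mem_toFinset, Set.mem_preimage, Finset.mem_coe,
      Finsupp.mem_support_iff]
    rw [← hw]
    simp only [weight, Finsupp.finsetSum_apply]
    have h1 : (∑ b ∈ T p, (Finsupp.single (idx b) 1 : ℕ+ →₀ ℕ) (idx a)) ≠ 0 := by
      intro h
      have := (Finset.sum_eq_zero_iff.1 h) a ha
      simp at this
    intro h
    exact h1 ((Finset.sum_eq_zero_iff.1 h) p p.2)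
  · intro T hT U hU h
    funext p
    by_cases hp : p ∈ E
    · exact congrFun h ⟨p, hp⟩
    · rw [hT.1.empty_outside p (by simp [hp]), hU.1.empty_outside p (by simp [hp])]

/-! ### Symmetric Grothendieck functions -/

/-- `SVT(λ // μ)`: set-valued tableaux of shape `λ // μ` whose entries are positive integers, with
rows weakly increasing and columns strictly increasing. -/
def SVT (lam mu : YoungDiagram) : Set (Filling ℕ+) :=
  {T | IsSetValued lam.cells mu.cells T ∧ ∀ i j, Disjoint (T (i, j)) (T (i + 1, j))}

/-- The skew symmetric Grothendieck function `G^(β)_{λ // μ}`, for `μ ⊆ λ`. -/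
noncomputable def skewG (β : ℝ) (lam mu : YoungDiagram) : MvPowerSeries ℕ+ ℝ :=
  tableauSeries id β lam.cells (lam.card - mu.card) (SVT lam mu)

/-- The symmetric Grothendieck function `G^(β)_λ = G^(β)_{λ // ∅}`. -/
noncomputable def G (β : ℝ) (lam : YoungDiagram) : MvPowerSeries ℕ+ ℝ :=
  skewG β lam ⊥

/-- `Γ^(β)`: the real span of all `G^(β)_{λ // μ}` with `μ ⊆ λ`. -/
noncomputable def Gamma (β : ℝ) : Submodule ℝ (MvPowerSeries ℕ+ ℝ) :=
  Submodule.span ℝ {f | ∃ lam mu : YoungDiagram, mu ≤ lam ∧ f = skewG β lam mu}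

/-- `G^(β)_λ` as an element of `Γ^(β)`. -/
noncomputable def GElt (β : ℝ) (lam : YoungDiagram) : Gamma β :=
  ⟨G β lam, Submodule.subset_span ⟨lam, ⊥, bot_le, rfl⟩⟩

/-! ### Shifted set-valued tableaux and `K`-theoretic Schur `Q`-functions -/

/-- A partition is strict if its nonzero parts are distinct. -/
def IsStrict (lam : YoungDiagram) : Prop :=
  ∀ i, 0 < lam.rowLen i → lam.rowLen (i + 1) < lam.rowLen i

/-- The shifted diagram: row `i` is moved `i` steps to the right. -/
def shiftedCells (lam : YoungDiagram) : Finset (ℕ × ℕ) :=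
  lam.cells.image fun p => (p.1, p.1 + p.2)

/-- The positive half-integers `1' < 1 < 2' < 2 < ⋯`, where `i' = i - 1/2`: the pair `(i, true)` is
the integer `i`, the pair `(i, false)` is `i'`, and the order is lexicographic. -/
abbrev Marked : Type := ℕ+ ×ₗ Bool

/-- The rounded-up value `⌈a⌉`, so that `⌈i⌉ = ⌈i'⌉ = i`. -/
def Marked.ceil (a : Marked) : ℕ+ := (ofLex a).1

/-- The letter is an integer `i`, rather than some `i'`. -/
def Marked.IsInteger (a : Marked) : Prop := (ofLex a).2 = true

/-- `ShSVT_Q(λ // μ)`: shifted set-valued tableaux, in which horizontally adjacent boxes may share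
only integers and vertically adjacent boxes may share only primed letters. -/
def ShSVTQ (lam mu : YoungDiagram) : Set (Filling Marked) :=
  {T | IsSetValued (shiftedCells lam) (shiftedCells mu) T ∧
    (∀ i j, ∀ a ∈ T (i, j) ∩ T (i, j + 1), a.IsInteger) ∧
    (∀ i j, ∀ a ∈ T (i, j) ∩ T (i + 1, j), ¬ a.IsInteger)}

/-- `ShSVT_Q(λ / μ)`: the elements of `ShSVT_Q(λ // μ)` that are empty on the boxes of `μ`. -/
def ShSVTQSlash (lam mu : YoungDiagram) : Set (Filling Marked) :=
  {T | T ∈ ShSVTQ lam mu ∧ ∀ p ∈ shiftedCells mu, T p = ∅}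

/-- The `K`-theoretic Schur `Q`-function `GQ^(β)_{λ // μ}`, for strict `μ ⊆ λ`. -/
noncomputable def skewGQ (β : ℝ) (lam mu : YoungDiagram) : MvPowerSeries ℕ+ ℝ :=
  tableauSeries Marked.ceil β (shiftedCells lam) (lam.card - mu.card) (ShSVTQ lam mu)

/-- The `K`-theoretic Schur `Q`-function `GQ^(β)_{λ / μ}`, for strict `μ ⊆ λ`. -/
noncomputable def slashGQ (β : ℝ) (lam mu : YoungDiagram) : MvPowerSeries ℕ+ ℝ :=
  tableauSeries Marked.ceil β (shiftedCells lam) (lam.card - mu.card) (ShSVTQSlash lam mu)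

/-- `Γ_Q^(β)`: the real span of all `GQ^(β)_{λ // μ}` with `μ ⊆ λ` strict. -/
noncomputable def GammaQ (β : ℝ) : Submodule ℝ (MvPowerSeries ℕ+ ℝ) :=
  Submodule.span ℝ {f | ∃ lam mu : YoungDiagram,
    IsStrict lam ∧ IsStrict mu ∧ mu ≤ lam ∧ f = skewGQ β lam mu}

/-! ### Staircases -/

/-- The Young diagram with rows of lengths `f 0 ≥ f 1 ≥ ⋯ ≥ f (n - 1)`. -/
def ofRows (n : ℕ) (f : ℕ → ℕ) (hf : Antitone f) : YoungDiagram where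
  cells := (Finset.range n).sigma (fun i => Finset.range (f i)) |>.map
    (Equiv.sigmaEquivProd ℕ ℕ).toEmbedding
  isLowerSet := by
    rintro ⟨i, j⟩ ⟨i', j'⟩ h hm
    obtain ⟨h1, h2⟩ := Prod.mk_le_mk.1 h
    simp only [Finset.coe_map, Set.mem_image, Finset.mem_coe, Finset.mem_sigma,
      Finset.mem_range] at hm ⊢
    obtain ⟨⟨a, b⟩, ⟨ha, hb⟩, hab⟩ := hm
    obtain ⟨rfl, rfl⟩ := Prod.mk.inj hab
    exact ⟨⟨i', j'⟩, ⟨h1.trans_lt ha, h2.trans_lt (hb.trans_le (hf h1))⟩, rfl⟩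

/-- The number of nonzero parts of a partition. -/
def numParts (lam : YoungDiagram) : ℕ := lam.colLen 0

/-- The staircase partition `(n, …, 3, 2, 1)`. -/
def staircase (n : ℕ) : YoungDiagram :=
  ofRows n (fun i => n - i) fun _ _ h => Nat.sub_le_sub_left h n

/-- `λ + δ = (λ_1 + n, λ_2 + n - 1, …, λ_n + 1)`, where `n` is the number of nonzero parts of `λ`
and `δ = (n, …, 2, 1)`. -/
def addStaircase (lam : YoungDiagram) : YoungDiagram :=
  ofRows (numParts lam) (fun i => lam.rowLen i + (numParts lam - i)) fun _ _ h =>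
    Nat.add_le_add (lam.rowLen_anti _ _ h) (Nat.sub_le_sub_left h _)

/-- `GQ^(β)_{(λ+δ)/δ}`. -/
noncomputable def stairGQ (β : ℝ) (lam : YoungDiagram) : MvPowerSeries ℕ+ ℝ :=
  slashGQ β (addStaircase lam) (staircase (numParts lam))

/-! ### The defining properties of the two maps -/

/-- `Ω` sends `G^(β)_λ` to `G^(β)_{λᵀ}` for all partitions `λ`. -/
def IsTransposeMap (β : ℝ) (Om : Gamma β →ₗ[ℝ] Gamma β) : Prop :=
  ∀ lam : YoungDiagram, Om (GElt β lam) = GElt β lam.transpose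

/-- `Θ` sends `G^(β)_λ` to `GQ^(β)_{(λ+δ)/δ}` for all partitions `λ`. -/
def IsThetaMap (β : ℝ) (Th : Gamma β →ₗ[ℝ] GammaQ β) : Prop :=
  ∀ lam : YoungDiagram, (Th (GElt β lam) : MvPowerSeries ℕ+ ℝ) = stairGQ β lam

end KSym

/-!
The proof replaces tableaux by operators on functions of partitions. For an integer `c`, the operator
`u_c` (`boxOp`) sends `f` to the function whose value at `lam` is `b f(lam) + f(lam ∖ p)` if `lam` has
a corner `p` of content `c`, and `0` otherwise. These operators satisfy the relations of a
`0`-Hecke algebra (`isHeckeFamily_boxOp`). A set-valued tableau is built up one letter in one box at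
a time, so that the generating function of the tableaux of shape `lam // mu` is an entry of a product
of factors `1 + x_a u_c` (`finsum_tabTerm`): a letter `a` which may be repeated in rows contributes
`H(x_a) = ⋯ (1 + x_a u_1) (1 + x_a u_0) (1 + x_a u_{-1}) ⋯`, and a letter which may be repeated in
columns contributes the product `V(x_a)` of the same factors in the opposite order.

By the Yang–Baxter equation the `H(x)` commute with each other (`IsHeckeFamily.commute_descProd`), and
since `V(x)` is inverse to `H(-x / (1 + b x))`, they also commute with the `V(x)`
(`IsHeckeFamily.commute_ascProd_descProd`).

* Commutation of the `H(x)` gives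
  `∑_nu G_nu(y) G_{lam // nu}(x) = ∑_nu G_nu(x) G_{lam // nu}(y)`. The coefficient of `y^mu` in `G_nu`
  is unitriangular for the order by sums of row numbers. Comparing coefficients of `y^mu` therefore
  expresses `G_{lam // mu}` by induction as a finite linear combination of the `G_nu`
  (`skewG_mem_span`); the same triangularity makes the `G_nu` linearly independent. So they form a
  basis of `Γ`, and linear maps on `Γ` are determined by arbitrary values on it.
* Sorting the tableaux of shape `lam // mu` by the boxes of `mu` they occupy expresses the
  `GQ_{lam // mu}` by the `GQ_{lam / nu}`, unitriangularly; inverting this shows that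
  `GQ_{(lam + δ) / δ}` lies in `Γ_Q` (`slashGQ_mem_GammaQ`).
* The skew shifted diagram of `(lam + δ) / δ` is a translate of the diagram of `lam`. Hence
  `GQ_{(lam + δ) / δ}` is the generating function of tableaux of shape `lam` in the letters
  `1' < 1 < 2' < 2 < ⋯`, an entry of the product of the `H(x_i) V(x_i)`. Transposing `lam` exchanges
  `H` and `V`, and as these commute the series does not change (`stairGQ_transpose`).
-/

namespace KSym

/-! ### Commuting products in the Hecke algebra -/

/-- The factor `1 + x u` of the products below. -/
def heckeFactor {R B : Type*} [CommRing R] [Ring B] [Algebra R B] (x : R) (u : B) : B :=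
  1 + x • u

/-- The integers `c, c + 1, …, c + n - 1`. -/
def contentList (c : ℤ) : ℕ → List ℤ
  | 0 => []
  | n + 1 => c :: contentList (c + 1) n

theorem mem_contentList {c d : ℤ} {n : ℕ} : d ∈ contentList c n ↔ c ≤ d ∧ d < c + n := by
  induction n generalizing c with
  | zero => simp [contentList]
  | succ n ih => simp only [contentList, List.mem_cons, ih]; push_cast; omega

theorem pairwise_contentList (c : ℤ) (n : ℕ) : (contentList c n).Pairwise (· < ·) := by
  induction n generalizing c with
  | zero => exact List.Pairwise.nil
  | succ n ih =>
    exact List.Pairwise.cons (fun d hd => by have := (mem_contentList.1 hd).1; omega) (ih _)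

/-- The product of the `1 + x u_d` for `d = c, …, c + n - 1`, indices increasing. -/
def ascProd {R B : Type*} [CommRing R] [Ring B] [Algebra R B] (u : ℤ → B) (c : ℤ) (n : ℕ) (x : R) :
    B :=
  ((contentList c n).map fun d => heckeFactor x (u d)).prod

/-- The product of the `1 + x u_d` for `d = c + n - 1, …, c`, indices decreasing. -/
def descProd {R B : Type*} [CommRing R] [Ring B] [Algebra R B] (u : ℤ → B) (c : ℤ) (n : ℕ)
    (x : R) : B :=
  ((contentList c n).reverse.map fun d => heckeFactor x (u d)).prod

/-- The relations of the (type A, two-sided infinite) Hecke algebra at `q = 0`, in the form in which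
the generators satisfy `u ^ 2 = b u`. -/
structure IsHeckeFamily {R B : Type*} [CommRing R] [Ring B] [Algebra R B] (b : R) (u : ℤ → B) :
    Prop where
  sq : ∀ c, u c * u c = b • u c
  comm : ∀ c d, c + 2 ≤ d → u c * u d = u d * u c
  braid : ∀ c, u c * u (c + 1) * u c = u (c + 1) * u c * u (c + 1)

section

variable {R B : Type*} [CommRing R] [Ring B] [Algebra R B] {b : R} {u : ℤ → B}

theorem ascProd_zero (c : ℤ) (x : R) : ascProd u c 0 x = 1 := rfl

theorem descProd_zero (c : ℤ) (x : R) : descProd u c 0 x = 1 := rfl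

theorem ascProd_succ (c : ℤ) (n : ℕ) (x : R) :
    ascProd u c (n + 1) x = heckeFactor x (u c) * ascProd u (c + 1) n x := by
  simp [ascProd, contentList]

theorem descProd_succ (c : ℤ) (n : ℕ) (x : R) :
    descProd u c (n + 1) x = descProd u (c + 1) n x * heckeFactor x (u c) := by
  simp [descProd, contentList]

theorem IsHeckeFamily.factor_mul (h : IsHeckeFamily b u) (c : ℤ) (x y : R) :
    heckeFactor x (u c) * heckeFactor y (u c) = heckeFactor (x + y + b * x * y) (u c) := by
  simp only [heckeFactor, mul_add, add_mul, mul_one, one_mul, smul_mul_assoc, mul_smul_comm, h.sq]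
  module

/-- The Yang–Baxter equation. -/
theorem IsHeckeFamily.yangBaxter (h : IsHeckeFamily b u) (c : ℤ) (x y z : R)
    (hz : z = x + y + b * x * y) :
    heckeFactor x (u c) * heckeFactor z (u (c + 1)) * heckeFactor y (u c) =
      heckeFactor y (u (c + 1)) * heckeFactor z (u c) * heckeFactor x (u (c + 1)) := by
  have e : ∀ (x y : R) (s t : B), z = x + y + b * x * y → s * s = b • s →
      heckeFactor x s * heckeFactor z t * heckeFactor y s =
        1 + z • s + z • t + (x * z) • (s * t) + (z * y) • (t * s) + (x * z * y) • (s * t * s) := by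
    intro x y s t hz hs
    simp only [heckeFactor, mul_add, add_mul, mul_one, one_mul, smul_mul_assoc, mul_smul_comm,
      mul_assoc, hs]
    subst hz
    module
  rw [e x y _ _ hz (h.sq _), e y x _ _ (by rw [hz]; ring) (h.sq _), h.braid]
  module

theorem IsHeckeFamily.commute_factor (h : IsHeckeFamily b u) {c d : ℤ} (hcd : c + 2 ≤ d) (x y : R) :
    Commute (heckeFactor x (u c)) (heckeFactor y (u d)) := by
  have h1 : Commute (u c) (u d) := h.comm c d hcd
  exact (((Commute.one_left _).add_left
    (((Commute.one_right _).add_right (h1.smul_right y)).smul_left x)))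

theorem IsHeckeFamily.commute_factor_descProd (h : IsHeckeFamily b u) {c d : ℤ} (hcd : c + 2 ≤ d)
    (n : ℕ) (x y : R) : Commute (heckeFactor x (u c)) (descProd u d n y) := by
  induction n generalizing d with
  | zero => exact Commute.one_right _
  | succ n ih =>
    rw [descProd_succ]
    exact (ih (by omega)).mul_right (h.commute_factor hcd x y)

/-- The decreasing products for two parameters commute. The element `x'` is the inverse of `x` for
the formal group law `x + y + b x y`. -/
theorem IsHeckeFamily.commute_descProd (h : IsHeckeFamily b u) {x x' : R}
    (hx : x + x' + b * x * x' = 0) (y : R) (c : ℤ) (n : ℕ) :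
    Commute (descProd u c n x) (descProd u c n y) := by
  induction n generalizing c with
  | zero => exact Commute.one_left _
  | succ n ih =>
    cases n with
    | zero =>
      simp only [descProd_succ, descProd_zero, one_mul]
      rw [Commute, SemiconjBy, h.factor_mul, h.factor_mul]
      congr 1; ring
    | succ n =>
      have key := ih (c + 1)
      rw [descProd_succ c, descProd_succ c]
      rw [descProd_succ (c + 1), descProd_succ (c + 1), show c + 1 + 1 = c + 2 by ring] at key ⊢
      set A := descProd u (c + 2) n x
      set A' := descProd u (c + 2) n y
      set p := heckeFactor x (u c) with hp
      set q := heckeFactor y (u c) with hq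
      set r := heckeFactor x (u (c + 1)) with hr
      set s := heckeFactor y (u (c + 1)) with hs
      set t := heckeFactor x' (u (c + 1)) with ht
      set w := heckeFactor (y + x' + b * y * x') (u (c + 1)) with hw
      have pA' : p * A' = A' * p := (h.commute_factor_descProd le_rfl n x y).eq
      have qA : q * A = A * q := (h.commute_factor_descProd le_rfl n y x).eq
      -- `y` is the formal sum of `x` and `y + x' + b y x'`.
      have yb : p * s * q = w * q * r * p := by
        have h1 := h.yangBaxter c x (y + x' + b * y * x') y (by linear_combination (-1 - b * y) * hx)
        rw [← hp, ← hs, ← hw, ← hq, ← hr] at h1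
        rw [← h1, mul_assoc (p * s), hp, h.factor_mul, hq]
        congr 2
        linear_combination (-1 - b * y) * hx
      have hst : s * t = w := by rw [hs, ht, h.factor_mul]
      have hrt : r * t = 1 := by rw [hr, ht, h.factor_mul, hx]; simp [heckeFactor]
      calc A * r * p * (A' * s * q)
          = A * r * A' * (p * s * q) := by
            simp only [mul_assoc]; rw [← mul_assoc p A', pA']; simp only [mul_assoc]
        _ = ((A * r) * (A' * s)) * (t * q * r * p) := by
            rw [yb, ← hst]; simp only [mul_assoc]
        _ = A' * s * A * (r * t) * (q * r * p) := by
            rw [key.eq]; simp only [mul_assoc]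
        _ = A' * s * q * (A * r * p) := by
            rw [hrt, mul_one]
            simp only [mul_assoc]; rw [← mul_assoc q A, qA]; simp only [mul_assoc]

theorem IsHeckeFamily.descProd_mul_ascProd (h : IsHeckeFamily b u) {x x' : R}
    (hx : x + x' + b * x * x' = 0) (c : ℤ) (n : ℕ) : descProd u c n x * ascProd u c n x' = 1 := by
  induction n generalizing c with
  | zero => simp [descProd_zero, ascProd_zero]
  | succ n ih =>
    rw [descProd_succ, ascProd_succ, mul_assoc, ← mul_assoc (heckeFactor x _), h.factor_mul, hx]
    simpa [heckeFactor] using ih (c + 1)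

theorem IsHeckeFamily.ascProd_mul_descProd (h : IsHeckeFamily b u) {x x' : R}
    (hx : x + x' + b * x * x' = 0) (c : ℤ) (n : ℕ) : ascProd u c n x' * descProd u c n x = 1 := by
  induction n generalizing c with
  | zero => simp [descProd_zero, ascProd_zero]
  | succ n ih =>
    rw [descProd_succ, ascProd_succ, mul_assoc, ← mul_assoc (ascProd _ _ _ _), ih, one_mul,
      h.factor_mul]
    have : x' + x + b * x' * x = 0 := by linear_combination hx
    simp [heckeFactor, this]

/-- Increasing products commute with decreasing ones, because they are inverse to decreasing
products. -/
theorem IsHeckeFamily.commute_ascProd_descProd (h : IsHeckeFamily b u) {x x' : R}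
    (hx : x + x' + b * x * x' = 0) (y : R) (c : ℤ) (n : ℕ) :
    Commute (ascProd u c n x) (descProd u c n y) := by
  have hx' : x' + x + b * x' * x = 0 := by linear_combination hx
  have h1 := h.ascProd_mul_descProd hx' c n
  have h2 := h.descProd_mul_ascProd hx' c n
  have h3 := (h.commute_descProd hx' y c n).eq
  set V := ascProd u c n x
  set P := descProd u c n x'
  set Q := descProd u c n y
  calc V * Q = V * Q * (P * V) := by rw [h2, mul_one]
    _ = V * (Q * P) * V := by simp only [mul_assoc]
    _ = (V * P) * Q * V := by rw [← h3]; simp only [mul_assoc]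
    _ = Q * V := by rw [h1, one_mul]

end

/-! ### Corners of Young diagrams and the box-adding operators -/

/-- The content `j - i` of the box `(i, j)`. -/
def content (p : ℕ × ℕ) : ℤ := (p.2 : ℤ) - p.1

/-- `p` is a corner (removable box) of `lam`. -/
structure IsCorner (lam : YoungDiagram) (p : ℕ × ℕ) : Prop where
  mem : p ∈ lam
  below : (p.1 + 1, p.2) ∉ lam
  right : (p.1, p.2 + 1) ∉ lam

/-- The diagram `lam` without the boxes weakly south-east of `p`. If `p` is a corner, only `p` is
removed. -/
def removeBox (lam : YoungDiagram) (p : ℕ × ℕ) : YoungDiagram where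
  cells := lam.cells.filter fun q => ¬ p ≤ q
  isLowerSet := by
    intro q r hrq hq
    simp only [Finset.coe_filter, Set.mem_ofPred_eq] at hq ⊢
    exact ⟨lam.isLowerSet hrq hq.1, fun h => hq.2 (h.trans hrq)⟩

theorem mem_of_le {lam : YoungDiagram} {p q : ℕ × ℕ} (hq : q ∈ lam) (h1 : p.1 ≤ q.1)
    (h2 : p.2 ≤ q.2) : p ∈ lam :=
  lam.up_left_mem h1 h2 hq

theorem removeBox_le (lam : YoungDiagram) (p : ℕ × ℕ) : removeBox lam p ≤ lam :=
  YoungDiagram.cells_subset_iff.1 (Finset.filter_subset _ _)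

theorem IsCorner.mem_removeBox {lam : YoungDiagram} {p q : ℕ × ℕ} (hp : IsCorner lam p) :
    q ∈ removeBox lam p ↔ q ∈ lam ∧ q ≠ p := by
  change q ∈ lam.cells.filter _ ↔ _
  rw [Finset.mem_filter, YoungDiagram.mem_cells]
  refine and_congr_right fun hq => ⟨fun h e => h (e ▸ le_rfl), fun h hpq => h ?_⟩
  obtain ⟨h1, h2⟩ := Prod.le_def.1 hpq
  by_contra
  rcases h1.lt_or_eq with h3 | h3
  · exact hp.below (mem_of_le hq h3 h2)
  · rcases h2.lt_or_eq with h4 | h4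
    · exact hp.right (mem_of_le hq h1 h4)
    · exact h (Prod.ext h3.symm h4.symm)

theorem IsCorner.cells_removeBox {lam : YoungDiagram} {p : ℕ × ℕ} (hp : IsCorner lam p) :
    (removeBox lam p).cells = lam.cells.erase p := by
  ext q
  rw [YoungDiagram.mem_cells, hp.mem_removeBox, Finset.mem_erase, YoungDiagram.mem_cells, and_comm]

theorem IsCorner.card_removeBox {lam : YoungDiagram} {p : ℕ × ℕ} (hp : IsCorner lam p) :
    (removeBox lam p).card + 1 = lam.card := by
  change (removeBox lam p).cells.card + 1 = lam.cells.card
  rw [hp.cells_removeBox]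
  exact Finset.card_erase_add_one hp.mem

theorem IsCorner.eq_of_content_eq {lam : YoungDiagram} {p q : ℕ × ℕ} (hp : IsCorner lam p)
    (hq : IsCorner lam q) (h : content p = content q) : p = q := by
  simp only [content] at h
  rcases lt_trichotomy p.1 q.1 with h1 | h1 | h1
  · exact absurd (mem_of_le hq.mem (p := (p.1 + 1, p.2)) h1 (by dsimp; omega)) hp.below
  · exact Prod.ext h1 (by omega)
  · exact absurd (mem_of_le hp.mem (p := (q.1 + 1, q.2)) h1 (by dsimp; omega)) hq.below

theorem IsCorner.content_ne_add_one {lam : YoungDiagram} {p q : ℕ × ℕ} (hp : IsCorner lam p)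
    (hq : IsCorner lam q) : content q ≠ content p + 1 := by
  intro h
  simp only [content] at h
  rcases le_or_gt p.1 q.1 with h1 | h1
  · exact hp.right (mem_of_le hq.mem h1 (by dsimp; omega))
  · exact hq.below (mem_of_le hp.mem h1 (by dsimp; omega))

/-- A box of the diagonal of a corner `p`, other than `p`, has both its lower and its right
neighbour in the diagram. -/
theorem IsCorner.mem_of_content_eq {lam : YoungDiagram} {p r : ℕ × ℕ} (hp : IsCorner lam p)
    (hr : r ∈ lam) (hne : r ≠ p) (h : content r = content p) :
    (r.1 + 1, r.2) ∈ lam ∧ (r.1, r.2 + 1) ∈ lam := by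
  simp only [content] at h
  rcases lt_trichotomy r.1 p.1 with h1 | h1 | h1
  · exact ⟨mem_of_le hp.mem h1 (by dsimp; omega), mem_of_le hp.mem h1.le (by dsimp; omega)⟩
  · exact absurd (Prod.ext h1 (by omega)) hne
  · exact absurd (mem_of_le hr (p := (p.1 + 1, p.2)) h1 (by dsimp; omega)) hp.below

theorem IsCorner.not_corner_removeBox {lam : YoungDiagram} {p r : ℕ × ℕ} (hp : IsCorner lam p)
    (h : content r = content p) : ¬ IsCorner (removeBox lam p) r := by
  intro hr
  obtain ⟨h1, h2⟩ := hp.mem_removeBox.1 hr.mem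
  refine hr.below (hp.mem_removeBox.2 ⟨(hp.mem_of_content_eq h1 h2 h).1, ?_⟩)
  rintro rfl
  simp only [content] at h
  push_cast at h
  omega

/-- After removing a corner `p` and then a corner on a neighbouring diagonal, there is no corner on
the diagonal of `p`. -/
theorem IsCorner.not_corner_removeBox_removeBox {lam : YoungDiagram} {p q r : ℕ × ℕ}
    (hp : IsCorner lam p) (hq : IsCorner (removeBox lam p) q) (h : content r = content p) :
    ¬ IsCorner (removeBox (removeBox lam p) q) r := by
  intro hr
  obtain ⟨h1, h2⟩ := hq.mem_removeBox.1 hr.mem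
  obtain ⟨h3, h4⟩ := hp.mem_removeBox.1 h1
  obtain ⟨h5, h6⟩ := hp.mem_of_content_eq h3 h4 h
  -- Removing one box cannot take away both neighbours of `r`.
  by_cases hqr : q = (r.1 + 1, r.2)
  · refine hr.right (hq.mem_removeBox.2 ⟨hp.mem_removeBox.2 ⟨h6, ?_⟩, ?_⟩)
    · rintro rfl; simp only [content] at h; push_cast at h; omega
    · rw [hqr]; intro e; simpa using congrArg Prod.fst e
  · refine hr.below (hq.mem_removeBox.2 ⟨hp.mem_removeBox.2 ⟨h5, ?_⟩, Ne.symm hqr⟩)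
    rintro rfl; simp only [content] at h; push_cast at h; omega

theorem IsCorner.corner_removeBox_iff {lam : YoungDiagram} {p q : ℕ × ℕ} (hp : IsCorner lam p)
    (h : content p + 2 ≤ content q ∨ content q + 2 ≤ content p) :
    IsCorner (removeBox lam p) q ↔ IsCorner lam q := by
  simp only [content] at h
  refine ⟨fun hq => ⟨removeBox_le _ _ hq.mem, fun h1 => ?_, fun h1 => ?_⟩, fun hq => ⟨?_, ?_, ?_⟩⟩
  · refine hq.below (hp.mem_removeBox.2 ⟨h1, ?_⟩)
    rintro rfl; push_cast at h; omega
  · refine hq.right (hp.mem_removeBox.2 ⟨h1, ?_⟩)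
    rintro rfl; push_cast at h; omega
  · refine hp.mem_removeBox.2 ⟨hq.mem, ?_⟩
    rintro rfl; omega
  · exact fun h1 => hq.below (removeBox_le _ _ h1)
  · exact fun h1 => hq.right (removeBox_le _ _ h1)

theorem IsCorner.removeBox_comm {lam : YoungDiagram} {p q : ℕ × ℕ} (hp : IsCorner lam p)
    (hq : IsCorner lam q) (hp' : IsCorner (removeBox lam q) p) (hq' : IsCorner (removeBox lam p) q) :
    removeBox (removeBox lam p) q = removeBox (removeBox lam q) p := by
  ext r
  simp only [YoungDiagram.mem_cells, hq'.mem_removeBox, hp.mem_removeBox, hp'.mem_removeBox,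
    hq.mem_removeBox]
  tauto

open Classical in
/-- The operator `u_c` on functions of partitions: if `lam` has a corner `p` of content `c`, then
`(u_c f) lam = b (f lam) + f (lam ∖ p)`, otherwise it vanishes. -/
noncomputable def boxOp {R : Type*} [CommRing R] (b : R) (c : ℤ) :
    Module.End R (YoungDiagram → R) where
  toFun f lam :=
    if h : ∃ p, IsCorner lam p ∧ content p = c then b * f lam + f (removeBox lam h.choose) else 0
  map_add' f g := by
    ext lam; simp only [Pi.add_apply]; split_ifs <;> ring
  map_smul' r f := by
    ext lam; simp only [Pi.smul_apply, smul_eq_mul, RingHom.id_apply]; split_ifs <;> ring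

section

variable {R : Type*} [CommRing R] {b : R}

theorem boxOp_apply {lam : YoungDiagram} {p : ℕ × ℕ} {c : ℤ} (hp : IsCorner lam p)
    (hc : content p = c) (f : YoungDiagram → R) :
    boxOp b c f lam = b * f lam + f (removeBox lam p) := by
  have h : ∃ p, IsCorner lam p ∧ content p = c := ⟨p, hp, hc⟩
  have e : h.choose = p := h.choose_spec.1.eq_of_content_eq hp (h.choose_spec.2.trans hc.symm)
  exact (dif_pos h).trans (by rw [e])

theorem boxOp_apply_of_not {lam : YoungDiagram} {c : ℤ}
    (h : ∀ p, content p = c → ¬ IsCorner lam p) (f : YoungDiagram → R) :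
    boxOp b c f lam = 0 :=
  dif_neg fun ⟨p, hp, hc⟩ => h p hc hp

theorem boxOp_sq (c : ℤ) : boxOp b c * boxOp b c = b • boxOp b c := by
  refine LinearMap.ext fun f => funext fun lam => ?_
  rw [Module.End.mul_apply, LinearMap.smul_apply, Pi.smul_apply, smul_eq_mul]
  by_cases h : ∃ p, content p = c ∧ IsCorner lam p
  · obtain ⟨p, hc, hp⟩ := h
    rw [boxOp_apply hp hc, boxOp_apply_of_not (lam := removeBox lam p), add_zero]
    exact fun q hq => hp.not_corner_removeBox (hq.trans hc.symm)
  · rw [boxOp_apply_of_not, boxOp_apply_of_not, mul_zero] <;>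
    exact fun p hc hp => h ⟨p, hc, hp⟩

theorem boxOp_mul_mul_eq_zero (c d : ℤ) (hd : d = c + 1 ∨ c = d + 1) :
    boxOp b c * boxOp b d * boxOp b c = 0 := by
  refine LinearMap.ext fun f => funext fun lam => ?_
  rw [Module.End.mul_apply, Module.End.mul_apply, LinearMap.zero_apply, Pi.zero_apply]
  by_cases h : ∃ p, content p = c ∧ IsCorner lam p
  · obtain ⟨p, hc, hp⟩ := h
    rw [boxOp_apply hp hc, boxOp_apply_of_not (lam := lam), mul_zero, zero_add]
    · by_cases h' : ∃ q, content q = d ∧ IsCorner (removeBox lam p) q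
      · obtain ⟨q, hq, hq'⟩ := h'
        rw [boxOp_apply hq' hq, boxOp_apply_of_not, boxOp_apply_of_not, mul_zero, zero_add]
        · exact fun r hr => hp.not_corner_removeBox_removeBox hq' (hr.trans hc.symm)
        · exact fun r hr => hp.not_corner_removeBox (hr.trans hc.symm)
      · exact boxOp_apply_of_not (fun q hq hq' => h' ⟨q, hq, hq'⟩) _
    · rintro q hq hq'
      rcases hd with rfl | rfl
      · exact hp.content_ne_add_one hq' (by rw [hq, hc])
      · exact hq'.content_ne_add_one hp (by rw [hq, hc])
  · exact boxOp_apply_of_not (fun p hc hp => h ⟨p, hc, hp⟩) _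

theorem boxOp_comm (c d : ℤ) (hcd : c + 2 ≤ d) : boxOp b c * boxOp b d = boxOp b d * boxOp b c := by
  refine LinearMap.ext fun f => funext fun lam => ?_
  rw [Module.End.mul_apply, Module.End.mul_apply]
  by_cases h : ∃ p, content p = c ∧ IsCorner lam p <;>
    by_cases h' : ∃ q, content q = d ∧ IsCorner lam q
  · obtain ⟨p, hc, hp⟩ := h
    obtain ⟨q, hd, hq⟩ := h'
    have hp' := (hq.corner_removeBox_iff (q := p) (by omega)).2 hp
    have hq' := (hp.corner_removeBox_iff (q := q) (by omega)).2 hq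
    rw [boxOp_apply hp hc, boxOp_apply hq hd, boxOp_apply hq' hd, boxOp_apply hq hd,
      boxOp_apply hp hc, boxOp_apply hp' hc, hp.removeBox_comm hq hp' hq']
    ring
  · obtain ⟨p, hc, hp⟩ := h
    rw [boxOp_apply hp hc, boxOp_apply_of_not (fun q hd hq => h' ⟨q, hd, hq⟩),
      boxOp_apply_of_not (fun q hd hq => h' ⟨q, hd, hq⟩), boxOp_apply_of_not, mul_zero, add_zero]
    exact fun q hd hq => h' ⟨q, hd, (hp.corner_removeBox_iff (by omega)).1 hq⟩
  · obtain ⟨q, hd, hq⟩ := h'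
    rw [boxOp_apply_of_not (fun q hd hq => h ⟨q, hd, hq⟩), boxOp_apply hq hd,
      boxOp_apply_of_not (fun q hd hq => h ⟨q, hd, hq⟩), boxOp_apply_of_not, mul_zero, add_zero]
    exact fun p hc hp => h ⟨p, hc, (hq.corner_removeBox_iff (by omega)).1 hp⟩
  · rw [boxOp_apply_of_not (fun q hd hq => h ⟨q, hd, hq⟩),
      boxOp_apply_of_not (fun q hd hq => h' ⟨q, hd, hq⟩)]

theorem isHeckeFamily_boxOp : IsHeckeFamily b (boxOp b) where
  sq := boxOp_sq
  comm := boxOp_comm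
  braid c := by
    rw [boxOp_mul_mul_eq_zero c (c + 1) (Or.inl rfl), boxOp_mul_mul_eq_zero (c + 1) c (Or.inr rfl)]

/-- A step `(a, c)` stands for the operator `1 + x_a u_c`; a list of steps stands for the product of
these operators, the rightmost of which acts first. -/
noncomputable def stepsOp {α : Type} (b : R) (x : α → R) (L : List (α × ℤ)) :
    Module.End R (YoungDiagram → R) :=
  (L.map fun s => heckeFactor (x s.1) (boxOp b s.2)).prod

theorem stepsOp_nil {α : Type} (x : α → R) : stepsOp b x [] = 1 := rfl

theorem stepsOp_cons {α : Type} (x : α → R) (s : α × ℤ) (L : List (α × ℤ)) :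
    stepsOp b x (s :: L) = heckeFactor (x s.1) (boxOp b s.2) * stepsOp b x L := by
  simp [stepsOp]

theorem heckeFactor_boxOp_apply (x : R) {lam : YoungDiagram} {p : ℕ × ℕ} {c : ℤ}
    (hp : IsCorner lam p) (hc : content p = c) (f : YoungDiagram → R) :
    heckeFactor x (boxOp b c) f lam = f lam + x * (b * f lam + f (removeBox lam p)) := by
  simp [heckeFactor, boxOp_apply hp hc]

theorem heckeFactor_boxOp_apply_of_not (x : R) {lam : YoungDiagram} {c : ℤ}
    (h : ∀ p, content p = c → ¬ IsCorner lam p) (f : YoungDiagram → R) :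
    heckeFactor x (boxOp b c) f lam = f lam := by
  simp [heckeFactor, boxOp_apply_of_not h]

open Classical in
/-- The indicator function of a partition. -/
noncomputable def delta (R : Type*) [CommRing R] (mu : YoungDiagram) : YoungDiagram → R :=
  fun lam => if lam = mu then 1 else 0

theorem stepsOp_congr {α : Type} (x : α → R) (L : List (α × ℤ)) {f g : YoungDiagram → R}
    (lam : YoungDiagram) (h : ∀ nu ≤ lam, f nu = g nu) : stepsOp b x L f lam = stepsOp b x L g lam := by
  induction L generalizing lam with
  | nil => exact h lam le_rfl
  | cons s L ih =>
    rw [stepsOp_cons, Module.End.mul_apply, Module.End.mul_apply]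
    by_cases hp : ∃ p, content p = s.2 ∧ IsCorner lam p
    · obtain ⟨p, hc, hp⟩ := hp
      rw [heckeFactor_boxOp_apply _ hp hc, heckeFactor_boxOp_apply _ hp hc, ih lam h,
        ih (removeBox lam p) fun nu hnu => h nu (hnu.trans (removeBox_le _ _))]
    · rw [heckeFactor_boxOp_apply_of_not _ fun p hc h => hp ⟨p, hc, h⟩,
        heckeFactor_boxOp_apply_of_not _ fun p hc h => hp ⟨p, hc, h⟩, ih lam h]

theorem finite_Iic (lam : YoungDiagram) : (Set.Iic lam).Finite :=
  Set.Finite.of_finite_image (f := YoungDiagram.cells)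
    (lam.cells.powerset.finite_toSet.subset (by
      rintro _ ⟨nu, hnu, rfl⟩
      simpa using YoungDiagram.cells_subset_iff.2 hnu))
    fun _ _ _ _ h => YoungDiagram.ext h

/-- The partitions contained in `lam`. -/
noncomputable def below (lam : YoungDiagram) : Finset YoungDiagram := (finite_Iic lam).toFinset

theorem mem_below {lam nu : YoungDiagram} : nu ∈ below lam ↔ nu ≤ lam := by simp [below]

theorem stepsOp_expand {α : Type} (x : α → R) (L : List (α × ℤ)) (f : YoungDiagram → R)
    (lam : YoungDiagram) :
    stepsOp b x L f lam = ∑ nu ∈ below lam, f nu * stepsOp b x L (delta R nu) lam := by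
  rw [stepsOp_congr x L (g := ∑ nu ∈ below lam, f nu • delta R nu) lam]
  · rw [map_sum, Finset.sum_apply]
    simp
  · intro nu hnu
    rw [Finset.sum_apply, Finset.sum_eq_single nu]
    · simp [delta]
    · intro k _ hk
      simp [delta, Ne.symm hk]
    · exact fun h => absurd (mem_below.2 hnu) h

theorem stepsOp_map {α : Type} {S : Type*} [CommRing S] (φ : R →+* S) (x : α → R)
    (L : List (α × ℤ)) (f : YoungDiagram → R) (lam : YoungDiagram) :
    stepsOp (φ b) (fun a => φ (x a)) L (fun nu => φ (f nu)) lam = φ (stepsOp b x L f lam) := by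
  induction L generalizing lam with
  | nil => rfl
  | cons s L ih =>
    rw [stepsOp_cons, stepsOp_cons, Module.End.mul_apply, Module.End.mul_apply]
    by_cases hp : ∃ p, content p = s.2 ∧ IsCorner lam p
    · obtain ⟨p, hc, hp⟩ := hp
      rw [heckeFactor_boxOp_apply _ hp hc, heckeFactor_boxOp_apply _ hp hc, ih lam,
        ih (removeBox lam p)]
      simp
    · rw [heckeFactor_boxOp_apply_of_not _ fun p hc h => hp ⟨p, hc, h⟩,
        heckeFactor_boxOp_apply_of_not _ fun p hc h => hp ⟨p, hc, h⟩, ih lam]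

theorem map_delta {S : Type*} [CommRing S] (φ : R →+* S) (mu : YoungDiagram) :
    (fun nu => φ (delta R mu nu)) = delta S mu := by
  funext nu
  simp only [delta]
  split_ifs <;> simp

/-! ### Transposition -/

theorem isCorner_transpose {lam : YoungDiagram} {p : ℕ × ℕ} :
    IsCorner lam.transpose p ↔ IsCorner lam p.swap := by
  constructor <;> rintro ⟨h1, h2, h3⟩ <;> constructor <;>
    simp only [YoungDiagram.mem_transpose, Prod.swap_prod_mk, Prod.fst_swap, Prod.snd_swap] at * <;>
    assumption

theorem content_swap (p : ℕ × ℕ) : content p.swap = -content p := by simp [content]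

theorem removeBox_transpose {lam : YoungDiagram} {p : ℕ × ℕ} (hp : IsCorner lam p.swap) :
    removeBox lam.transpose p = (removeBox lam p.swap).transpose := by
  ext q
  rw [YoungDiagram.mem_cells, (isCorner_transpose.2 hp).mem_removeBox, YoungDiagram.mem_cells,
    YoungDiagram.mem_transpose, YoungDiagram.mem_transpose, hp.mem_removeBox, ne_eq, ne_eq,
    Prod.swap_inj]

/-- Precomposition with transposition turns `u_c` into `u_{-c}`. -/
theorem boxOp_transpose (c : ℤ) (f : YoungDiagram → R) (lam : YoungDiagram) :
    boxOp b c f lam.transpose = boxOp b (-c) (fun nu => f nu.transpose) lam := by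
  by_cases h : ∃ p, content p = c ∧ IsCorner lam.transpose p
  · obtain ⟨p, hc, hp⟩ := h
    have hp' := isCorner_transpose.1 hp
    rw [boxOp_apply hp hc, boxOp_apply hp' (by rw [content_swap, hc]), removeBox_transpose hp']
  · rw [boxOp_apply_of_not (fun p hc hp => h ⟨p, hc, hp⟩), boxOp_apply_of_not]
    intro p hc hp
    refine h ⟨p.swap, by rw [content_swap, hc, neg_neg], isCorner_transpose.2 (by simpa using hp)⟩

theorem stepsOp_transpose {α : Type} (x : α → R) (L : List (α × ℤ)) (f : YoungDiagram → R)
    (lam : YoungDiagram) :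
    stepsOp b x L f lam.transpose =
      stepsOp b x (L.map fun s => (s.1, -s.2)) (fun nu => f nu.transpose) lam := by
  induction L generalizing lam with
  | nil => rfl
  | cons s L ih =>
    rw [List.map_cons, stepsOp_cons, stepsOp_cons, Module.End.mul_apply, Module.End.mul_apply]
    have e : (fun nu => stepsOp b x L f nu.transpose) =
        stepsOp b x (L.map fun s => (s.1, -s.2)) (fun nu => f nu.transpose) := funext ih
    simp only [heckeFactor, LinearMap.add_apply, LinearMap.smul_apply, Module.End.one_apply,
      Pi.add_apply, Pi.smul_apply, boxOp_transpose, ← e]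

end

/-! ### Generating functions of set-valued tableaux -/

/-- Set-valued tableaux of shape `lam // mu` in an alphabet with two kinds of letters: those
satisfying `r` may be shared by boxes that are neighbours in a row, the other ones by boxes that are
neighbours in a column. A letter `a` may occur in a box of content `c` only if `(a, c) ∈ L`. -/
structure IsTableau {α : Type} [LinearOrder α] (r : α → Prop) (L : List (α × ℤ))
    (lam mu : YoungDiagram) (T : Filling α) : Prop where
  le : mu ≤ lam
  isSetValued : IsSetValued lam.cells mu.cells T
  row : ∀ i j, ∀ a ∈ T (i, j), a ∈ T (i, j + 1) → r a
  col : ∀ i j, ∀ a ∈ T (i, j), a ∈ T (i + 1, j) → ¬ r a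
  steps : ∀ p, ∀ a ∈ T p, (a, content p) ∈ L

/-- The order in which a tableau is built up: smaller letters first, and the copies of one letter by
increasing content if it may be repeated in rows, by decreasing content otherwise. -/
def StepLT {α : Type} [LinearOrder α] (r : α → Prop) (s t : α × ℤ) : Prop :=
  s.1 < t.1 ∨ s.1 = t.1 ∧ (r s.1 ∧ s.2 < t.2 ∨ ¬ r s.1 ∧ t.2 < s.2)

/-- The filling `T` with the letter `a` added to box `p`. -/
def addLetter {α : Type} [DecidableEq α] (p : ℕ × ℕ) (a : α) (T : Filling α) : Filling α :=
  Function.update T p (insert a (T p))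

/-- The term `b ^ (|T| - N) x^T` of a tableau. -/
noncomputable def tabTerm {α : Type} {R : Type*} [CommRing R] (b : R) (x : α → R) (E : Finset (ℕ × ℕ)) (N : ℕ)
    (T : Filling α) : R :=
  b ^ (size E T - N) * ∏ p ∈ E, ∏ a ∈ T p, x a

theorem card_sub_le_size {α : Type} {T : Filling α} {E D : Finset (ℕ × ℕ)} (h : ∀ p ∈ E \ D, (T p).Nonempty) :
    (E \ D).card ≤ size E T := by
  rw [Finset.card_eq_sum_ones]
  exact (Finset.sum_le_sum fun p hp => Finset.card_pos.2 (h p hp)).trans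
    (Finset.sum_le_sum_of_subset Finset.sdiff_subset)

section

variable {α : Type} [LinearOrder α] {r : α → Prop} {L : List (α × ℤ)} {lam mu : YoungDiagram}
  {T : Filling α} {a : α} {c : ℤ} {p : ℕ × ℕ}

theorem addLetter_self : addLetter p a T p = insert a (T p) := Function.update_self _ _ _

theorem addLetter_of_ne {q : ℕ × ℕ} (h : q ≠ p) : addLetter p a T q = T q :=
  Function.update_of_ne h _ _

theorem mem_addLetter {q : ℕ × ℕ} {d : α} :
    d ∈ addLetter p a T q ↔ d ∈ T q ∨ q = p ∧ d = a := by
  by_cases h : q = p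
  · subst h; rw [addLetter_self, Finset.mem_insert]; tauto
  · rw [addLetter_of_ne h]; tauto

theorem size_addLetter {E : Finset (ℕ × ℕ)} (hp : p ∈ E) (ha : a ∉ T p) :
    size E (addLetter p a T) = size E T + 1 := by
  unfold size
  rw [← Finset.add_sum_erase _ _ hp, ← Finset.add_sum_erase E (fun p => (T p).card) hp,
    addLetter_self, Finset.card_insert_of_notMem ha,
    Finset.sum_congr rfl fun q hq => by rw [addLetter_of_ne (Finset.ne_of_mem_erase hq)]]
  ring

theorem prod_addLetter {R : Type*} [CommRing R] (x : α → R) {E : Finset (ℕ × ℕ)} (hp : p ∈ E)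
    (ha : a ∉ T p) :
    ∏ q ∈ E, ∏ d ∈ addLetter p a T q, x d = x a * ∏ q ∈ E, ∏ d ∈ T q, x d := by
  rw [← Finset.mul_prod_erase _ _ hp, ← Finset.mul_prod_erase E (fun q => ∏ d ∈ T q, x d) hp,
    addLetter_self, Finset.prod_insert ha,
    Finset.prod_congr (s₁ := E.erase p) rfl fun q hq => by
      rw [addLetter_of_ne (Finset.ne_of_mem_erase hq)], mul_assoc]

theorem IsTableau.mem (hT : IsTableau r L lam mu T) (ha : a ∈ T p) :
    p ∈ lam ∧ p ∉ interior mu.cells := by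
  have : p ∈ lam.cells \ interior mu.cells := by
    by_contra h
    simp [hT.isSetValued.empty_outside p h] at ha
  simpa using this

theorem IsTableau.nonempty (hT : IsTableau r L lam mu T) (h1 : p ∈ lam) (h2 : p ∉ mu) :
    (T p).Nonempty :=
  hT.isSetValued.nonempty p (Finset.mem_sdiff.2 ⟨h1, h2⟩)

theorem notMem_interior {p : ℕ × ℕ} :
    p ∉ interior mu.cells ↔ p ∈ mu → (p.1 + 1, p.2) ∉ mu ∧ (p.1, p.2 + 1) ∉ mu := by
  simp [interior]

theorem IsCorner.notMem_interior (hp : IsCorner lam p) (h : mu ≤ lam) : p ∉ interior mu.cells :=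
  KSym.notMem_interior.2 fun _ => ⟨fun h' => hp.below (h h'), fun h' => hp.right (h h')⟩

/-- The box of the last letter added to a tableau is a corner. -/
theorem IsTableau.isCorner (hT : IsTableau r ((a, c) :: L) lam mu T)
    (hL : ∀ t ∈ L, StepLT r t (a, c)) (ha : a ∈ T p) (hc : content p = c) : IsCorner lam p := by
  obtain ⟨h1, h2⟩ := hT.mem ha
  obtain ⟨i, j⟩ := p
  have h3 : (i, j) ∈ mu → (i + 1, j) ∉ mu ∧ (i, j + 1) ∉ mu := notMem_interior.1 h2
  refine ⟨h1, fun h => ?_, fun h => ?_⟩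
  · have h4 : (i + 1, j) ∉ mu := fun h' => (h3 (mem_of_le h' (by simp) le_rfl)).1 h'
    obtain ⟨d, hd⟩ := hT.nonempty h h4
    have h5 := hT.isSetValued.col_le i j a ha d hd
    have h6 := hT.steps _ _ hd
    have h7 : content (i + 1, j) = c - 1 := by rw [← hc]; simp only [content]; push_cast; ring
    rw [h7] at h6
    rcases List.mem_cons.1 h6 with h8 | h8
    · have := congrArg Prod.snd h8; dsimp at this; omega
    · rcases hL _ h8 with h9 | ⟨h9, h10 | h10⟩
      · exact absurd h9 (not_lt.2 h5)
      · dsimp at h9; subst h9; exact hT.col _ _ _ ha hd h10.1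
      · have := h10.2; dsimp at this; omega
  · have h4 : (i, j + 1) ∉ mu := fun h' => (h3 (mem_of_le h' le_rfl (by simp))).2 h'
    obtain ⟨d, hd⟩ := hT.nonempty h h4
    have h5 := hT.isSetValued.row_le i j a ha d hd
    have h6 := hT.steps _ _ hd
    have h7 : content (i, j + 1) = c + 1 := by rw [← hc]; simp only [content]; push_cast; ring
    rw [h7] at h6
    rcases List.mem_cons.1 h6 with h8 | h8
    · have := congrArg Prod.snd h8; dsimp at this; omega
    · rcases hL _ h8 with h9 | ⟨h9, h10 | h10⟩
      · exact absurd h9 (not_lt.2 h5)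
      · have := h10.2; dsimp at this; omega
      · dsimp at h9; subst h9; exact h10.1 (hT.row _ _ _ ha hd)

theorem IsTableau.mono {L' : List (α × ℤ)} (hT : IsTableau r L lam mu T)
    (h : ∀ p, ∀ a ∈ T p, (a, content p) ∈ L') : IsTableau r L' lam mu T :=
  { hT with steps := h }

theorem IsTableau.cons {s : α × ℤ} (hT : IsTableau r L lam mu T) :
    IsTableau r (s :: L) lam mu T :=
  hT.mono fun p a ha => List.mem_cons_of_mem _ (hT.steps p a ha)

/-- Adding a new largest letter to a corner, either one in which letters are already allowed or a
new box. -/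
theorem IsTableau.addLetter {kap : YoungDiagram} (hp : IsCorner lam p) (hc : content p = c)
    (hkap : kap = lam ∨ kap = removeBox lam p) (hL : ∀ t ∈ L, StepLT r t (a, c))
    (hT : IsTableau r L kap mu T) : IsTableau r ((a, c) :: L) lam mu (addLetter p a T) := by
  have hle : kap ≤ lam := by
    rcases hkap with rfl | rfl
    exacts [le_rfl, removeBox_le _ _]
  have hout : ∀ q, q ∉ lam → T q = ∅ := fun q hq => by
    by_contra h
    obtain ⟨d, hd⟩ := Finset.nonempty_iff_ne_empty.2 h
    exact hq (hle (hT.mem hd).1)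
  have hlt : ∀ q d, d ∈ T q → StepLT r (d, content q) (a, c) := fun q d hd => hL _ (hT.steps _ _ hd)
  obtain ⟨i, j⟩ := p
  refine ⟨hT.le.trans hle, ⟨?_, ?_, ?_, ?_⟩, ?_, ?_, ?_⟩
  · intro q hq
    have hqp : q ≠ (i, j) := by
      rintro rfl
      exact hq (Finset.mem_sdiff.2 ⟨hp.mem, hp.notMem_interior (hT.le.trans hle)⟩)
    rw [addLetter_of_ne hqp]
    refine hT.isSetValued.empty_outside q fun h => hq ?_
    rw [Finset.mem_sdiff] at h ⊢
    exact ⟨hle h.1, h.2⟩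
  · intro q hq
    by_cases hqp : q = (i, j)
    · subst hqp; rw [addLetter_self]; exact Finset.insert_nonempty _ _
    · rw [addLetter_of_ne hqp]
      rw [Finset.mem_sdiff, YoungDiagram.mem_cells, YoungDiagram.mem_cells] at hq
      refine hT.nonempty ?_ hq.2
      rcases hkap with rfl | rfl
      exacts [hq.1, hp.mem_removeBox.2 ⟨hq.1, hqp⟩]
  · intro i' j' d hd0 e he0
    rcases mem_addLetter.1 he0 with he | ⟨he, rfl⟩
    · rcases mem_addLetter.1 hd0 with hd | ⟨hd, rfl⟩
      · exact hT.isSetValued.row_le _ _ d hd e he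
      · cases hd; rw [hout _ hp.right] at he; simp at he
    · rcases mem_addLetter.1 hd0 with hd | ⟨hd, rfl⟩
      · rcases hlt _ _ hd with h | h
        exacts [h.le, h.1.le]
      · rfl
  · intro i' j' d hd0 e he0
    rcases mem_addLetter.1 he0 with he | ⟨he, rfl⟩
    · rcases mem_addLetter.1 hd0 with hd | ⟨hd, rfl⟩
      · exact hT.isSetValued.col_le _ _ d hd e he
      · cases hd; rw [hout _ hp.below] at he; simp at he
    · rcases mem_addLetter.1 hd0 with hd | ⟨hd, rfl⟩
      · rcases hlt _ _ hd with h | h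
        exacts [h.le, h.1.le]
      · rfl
  · intro i' j' d hd0 he0
    rcases mem_addLetter.1 he0 with he | ⟨he, rfl⟩
    · rcases mem_addLetter.1 hd0 with hd | ⟨hd, rfl⟩
      · exact hT.row _ _ d hd he
      · cases hd; rw [hout _ hp.right] at he; simp at he
    · rcases mem_addLetter.1 hd0 with hd | ⟨hd, -⟩
      · rcases hlt _ _ hd with h | ⟨-, h | h⟩
        · exact absurd h (lt_irrefl _)
        · exact h.1
        · have := h.2
          rw [← hc, ← he] at this
          simp only [content] at this
          push_cast at this; omega
      · rw [← hd] at he; simp at he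
  · intro i' j' d hd0 he0
    rcases mem_addLetter.1 he0 with he | ⟨he, rfl⟩
    · rcases mem_addLetter.1 hd0 with hd | ⟨hd, rfl⟩
      · exact hT.col _ _ d hd he
      · cases hd; rw [hout _ hp.below] at he; simp at he
    · rcases mem_addLetter.1 hd0 with hd | ⟨hd, -⟩
      · rcases hlt _ _ hd with h | ⟨-, h | h⟩
        · exact absurd h (lt_irrefl _)
        · have := h.2
          rw [← hc, ← he] at this
          simp only [content] at this
          push_cast at this; omega
        · exact h.1
      · rw [← hd] at he; simp at he
  · intro q d hd
    rcases mem_addLetter.1 hd with hd | ⟨rfl, rfl⟩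
    · exact List.mem_cons_of_mem _ (hT.steps _ _ hd)
    · rw [hc]; exact List.mem_cons_self

/-- Every tableau in which the last step `(a, c)` is used arises by adding a letter. -/
theorem IsTableau.exists_eq_addLetter (hT : IsTableau r ((a, c) :: L) lam mu T)
    (hL : ∀ t ∈ L, StepLT r t (a, c)) (ha : a ∈ T p) (hc : content p = c) :
    ∃ T', (IsTableau r L lam mu T' ∨ IsTableau r L (removeBox lam p) mu T') ∧
      KSym.addLetter p a T' = T := by
  have hp := hT.isCorner hL ha hc
  set T' : Filling α := Function.update T p ((T p).erase a) with hT'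
  have hself : T' p = (T p).erase a := Function.update_self _ _ _
  have hne : ∀ q, q ≠ p → T' q = T q := fun q hq => Function.update_of_ne hq _ _
  have hsub : ∀ q, ∀ d ∈ T' q, d ∈ T q := fun q d hd => by
    by_cases hq : q = p
    · subst hq; rw [hself] at hd; exact Finset.mem_of_mem_erase hd
    · rwa [hne q hq] at hd
  have hadd : KSym.addLetter p a T' = T := by
    funext q
    by_cases hq : q = p
    · subst hq; rw [addLetter_self, hself, Finset.insert_erase ha]
    · rw [addLetter_of_ne hq, hne q hq]
  have hsteps : ∀ q, ∀ d ∈ T' q, (d, content q) ∈ L := by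
    intro q d hd
    rcases List.mem_cons.1 (hT.steps q d (hsub q d hd)) with h | h
    · obtain ⟨rfl, h2⟩ : d = a ∧ content q = c := Prod.mk.inj h
      have hqp : q = p :=
        (hT.isCorner hL (hsub q d hd) h2).eq_of_content_eq hp (h2.trans hc.symm)
      rw [hqp, hself] at hd
      exact absurd rfl (Finset.ne_of_mem_erase hd)
    · exact h
  have hempty : ∀ q, T q = ∅ → T' q = ∅ := fun q hq => by
    refine Finset.eq_empty_of_forall_notMem fun d hd => ?_
    simpa [hq] using hsub q d hd
  have hrow : ∀ i j, SetLE (T' (i, j)) (T' (i, j + 1)) := fun i j d hd e he =>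
    hT.isSetValued.row_le i j d (hsub _ _ hd) e (hsub _ _ he)
  have hcol : ∀ i j, SetLE (T' (i, j)) (T' (i + 1, j)) := fun i j d hd e he =>
    hT.isSetValued.col_le i j d (hsub _ _ hd) e (hsub _ _ he)
  refine ⟨T', ?_, hadd⟩
  by_cases h : p ∈ mu ∨ (T' p).Nonempty
  · refine Or.inl ⟨hT.le, ⟨fun q hq => hempty q (hT.isSetValued.empty_outside q hq), ?_, hrow, hcol⟩,
      fun i j d hd he => hT.row i j d (hsub _ _ hd) (hsub _ _ he),
      fun i j d hd he => hT.col i j d (hsub _ _ hd) (hsub _ _ he), hsteps⟩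
    intro q hq
    by_cases hqp : q = p
    · subst hqp
      exact h.resolve_left (Finset.mem_sdiff.1 hq).2
    · rw [hne q hqp]; exact hT.isSetValued.nonempty q hq
  · rw [not_or, Finset.not_nonempty_iff_eq_empty] at h
    refine Or.inr ⟨fun q hq => hp.mem_removeBox.2 ⟨hT.le hq, fun e => h.1 (e ▸ hq)⟩,
      ⟨?_, ?_, hrow, hcol⟩,
      fun i j d hd he => hT.row i j d (hsub _ _ hd) (hsub _ _ he),
      fun i j d hd he => hT.col i j d (hsub _ _ hd) (hsub _ _ he), hsteps⟩
    · intro q hq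
      by_cases hqp : q = p
      · rw [hqp]; exact h.2
      · refine hempty q (hT.isSetValued.empty_outside q fun h' => hq ?_)
        rw [Finset.mem_sdiff] at h' ⊢
        exact ⟨hp.mem_removeBox.2 ⟨h'.1, hqp⟩, h'.2⟩
    · intro q hq
      rw [Finset.mem_sdiff] at hq
      obtain ⟨h1, h2⟩ := hp.mem_removeBox.1 hq.1
      rw [hne q h2]
      exact hT.nonempty h1 hq.2

theorem finite_isTableau (r : α → Prop) (L : List (α × ℤ)) (lam mu : YoungDiagram) :
    {T | IsTableau r L lam mu T}.Finite := by
  classical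
  let A : Finset α := (L.map Prod.fst).toFinset
  refine Set.Finite.of_finite_image (f := fun (T : Filling α) (p : lam.cells) => T p)
    ((Set.Finite.pi' (t := fun _ : lam.cells => (A.powerset : Set (Finset α)))
      fun _ => Finset.finite_toSet _).subset ?_) ?_
  · rintro _ ⟨T, hT, rfl⟩ p
    simp only [Finset.mem_coe, Finset.mem_powerset]
    intro a ha
    exact List.mem_toFinset.2 (List.mem_map.2 ⟨_, hT.steps _ a ha, rfl⟩)
  · intro T hT U hU h
    funext p
    by_cases hp : p ∈ lam.cells
    · exact congrFun h ⟨p, hp⟩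
    · rw [hT.isSetValued.empty_outside p (by simp_all),
        hU.isSetValued.empty_outside p (by simp_all)]

theorem IsTableau.card_sub_le_size (hT : IsTableau r L lam mu T) :
    lam.card - mu.card ≤ size lam.cells T := by
  refine le_trans (le_of_eq ?_) (KSym.card_sub_le_size hT.isSetValued.nonempty)
  rw [Finset.card_sdiff_of_subset (YoungDiagram.cells_subset_iff.2 hT.le)]

theorem IsTableau.notMem_of_stepLT (hT : IsTableau r L lam mu T) (hL : ∀ t ∈ L, StepLT r t (a, c))
    (hc : content p = c) : a ∉ T p := fun h => by
  have := hL _ (hT.steps p a h)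
  simp [StepLT, hc] at this

/-- The sum of the terms of all tableaux of shape `lam // mu` is an entry of the product of the
operators `1 + x_a u_c`. The induction removes the last letter added. -/
theorem finsum_tabTerm {R : Type*} [CommRing R] (b : R) (x : α → R)
    (hL : L.Pairwise fun s t => StepLT r t s) (lam mu : YoungDiagram) :
    ∑ᶠ T ∈ {T | IsTableau r L lam mu T}, tabTerm b x lam.cells (lam.card - mu.card) T =
      stepsOp b x L (delta R mu) lam := by
  induction L generalizing lam with
  | nil =>
    rw [stepsOp_nil, Module.End.one_apply, delta]
    have hT : ∀ T, IsTableau r [] lam mu T → T = (fun _ => ∅) := fun T hT => funext fun p =>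
      Finset.eq_empty_of_forall_notMem fun a ha => by simpa using hT.steps p a ha
    split_ifs with h
    · subst h
      have e : {T | IsTableau r [] lam lam T} = {fun _ : ℕ × ℕ => (∅ : Finset α)} := by
        refine Set.eq_singleton_iff_unique_mem.2 ⟨⟨le_rfl, ⟨?_, ?_, ?_, ?_⟩, ?_, ?_, ?_⟩, hT⟩ <;>
          simp [SetLE]
      rw [e, finsum_mem_singleton]
      simp [tabTerm, size]
    · have e : {T | IsTableau r [] lam mu T} = ∅ := by
        refine Set.eq_empty_of_forall_notMem fun T h' => h ?_
        have h' : IsTableau r [] lam mu T := h'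
        refine le_antisymm (fun p hp => ?_) h'.le
        by_contra hp'
        obtain ⟨a, ha⟩ := h'.nonempty hp hp'
        simpa using h'.steps p a ha
      rw [e, finsum_mem_empty]
  | cons s L ih =>
    obtain ⟨a, c⟩ := s
    obtain ⟨hL1, hL2⟩ := List.pairwise_cons.1 hL
    rw [stepsOp_cons, Module.End.mul_apply]
    by_cases h : ∃ p, content p = c ∧ IsCorner lam p
    · obtain ⟨p, hc, hp⟩ := h
      rw [heckeFactor_boxOp_apply _ hp hc, ← ih hL2, ← ih hL2]
      have hnot : ∀ kap, ∀ T ∈ {T | IsTableau r L kap mu T}, a ∉ T p :=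
        fun kap T hT => IsTableau.notMem_of_stepLT hT hL1 hc
      have hinj : ∀ kap, Set.InjOn (addLetter p a) {T | IsTableau r L kap mu T} := by
        intro kap T hT U hU e
        funext q
        by_cases hq : q = p
        · subst hq
          have := congrFun e q
          rw [addLetter_self, addLetter_self] at this
          rw [← Finset.erase_insert (hnot _ T hT), this, Finset.erase_insert (hnot _ U hU)]
        · have := congrFun e q
          rwa [addLetter_of_ne hq, addLetter_of_ne hq] at this
      have e : {T | IsTableau r ((a, c) :: L) lam mu T} = {T | IsTableau r L lam mu T} ∪
          (addLetter p a '' {T | IsTableau r L lam mu T} ∪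
            addLetter p a '' {T | IsTableau r L (removeBox lam p) mu T}) := by
        ext T
        constructor
        · intro hT
          have hT : IsTableau r ((a, c) :: L) lam mu T := hT
          by_cases h : ∃ q, a ∈ T q ∧ content q = c
          · obtain ⟨q, hq, hq'⟩ := h
            obtain rfl := (hT.isCorner hL1 hq hq').eq_of_content_eq hp (hq'.trans hc.symm)
            obtain ⟨T', h' | h', rfl⟩ := hT.exists_eq_addLetter hL1 hq hq'
            exacts [Or.inr (Or.inl ⟨T', h', rfl⟩), Or.inr (Or.inr ⟨T', h', rfl⟩)]
          · refine Or.inl (hT.mono fun q d hd => ?_)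
            rcases List.mem_cons.1 (hT.steps q d hd) with h' | h'
            · obtain ⟨rfl, h2⟩ : d = a ∧ content q = c := Prod.mk.inj h'
              exact absurd ⟨q, hd, h2⟩ h
            · exact h'
        · rintro (hT | ⟨T', hT, rfl⟩ | ⟨T', hT, rfl⟩)
          · exact IsTableau.cons hT
          · exact IsTableau.addLetter hp hc (Or.inl rfl) hL1 hT
          · exact IsTableau.addLetter hp hc (Or.inr rfl) hL1 hT
      have hf := finite_isTableau r L lam mu
      have hf' := finite_isTableau r L (removeBox lam p) mu
      have hcard := hp.card_removeBox
      rw [e, finsum_mem_union _ hf ((hf.image _).union (hf'.image _)),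
        finsum_mem_union _ (hf.image _) (hf'.image _), finsum_mem_image (hinj _),
        finsum_mem_image (hinj _), mul_add, ← mul_assoc, mul_finsum_mem' _ _ hf, mul_finsum_mem' _ _ hf']
      · congr 2
        · refine finsum_mem_congr rfl fun T hT => ?_
          have h1 := IsTableau.card_sub_le_size hT
          rw [tabTerm, tabTerm, size_addLetter hp.mem (hnot _ T hT), prod_addLetter x hp.mem
            (hnot _ T hT), Nat.sub_add_comm h1, pow_succ]
          ring
        · refine finsum_mem_congr rfl fun T hT => ?_
          have h0 : mu.card ≤ (removeBox lam p).card := Finset.card_le_card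
            (YoungDiagram.cells_subset_iff.2 (IsTableau.le hT))
          have hTp : T p = ∅ := IsSetValued.empty_outside (IsTableau.isSetValued hT) p fun h => by
            exact (hp.mem_removeBox.1 (Finset.mem_sdiff.1 h).1).2 rfl
          have e1 : size lam.cells T = size (removeBox lam p).cells T := by
            rw [hp.cells_removeBox, size, size, ← Finset.add_sum_erase _ _ hp.mem, hTp]; simp
          have e2 : ∏ q ∈ lam.cells, ∏ d ∈ T q, x d =
              ∏ q ∈ (removeBox lam p).cells, ∏ d ∈ T q, x d := by
            rw [hp.cells_removeBox, ← Finset.mul_prod_erase _ _ hp.mem, hTp]; simp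
          rw [tabTerm, tabTerm, size_addLetter hp.mem (hnot _ T hT), prod_addLetter x hp.mem
            (hnot _ T hT), e1, e2, show lam.card - mu.card = (removeBox lam p).card - mu.card + 1 by
              omega, Nat.add_sub_add_right]
          ring
      · refine Set.disjoint_left.2 ?_
        rintro _ ⟨T, hT, rfl⟩ ⟨U, hU, e⟩
        have hT : IsTableau r L lam mu T := hT
        have hU : IsTableau r L (removeBox lam p) mu U := hU
        have hUp : U p = ∅ := hU.isSetValued.empty_outside p fun h =>
          (hp.mem_removeBox.1 (Finset.mem_sdiff.1 h).1).2 rfl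
        have hpm : p ∉ mu := fun h => (hp.mem_removeBox.1 (hU.le h)).2 rfl
        obtain ⟨d, hd⟩ := hT.nonempty hp.mem hpm
        have h2 : d ∈ addLetter p a U p := by rw [e]; exact mem_addLetter.2 (Or.inl hd)
        rcases mem_addLetter.1 h2 with h2 | ⟨-, rfl⟩
        · simp [hUp] at h2
        · exact hnot _ T hT hd
      · refine Set.disjoint_left.2 ?_
        rintro _ hT (⟨U, hU, rfl⟩ | ⟨U, hU, rfl⟩) <;>
        exact hnot _ _ hT (mem_addLetter.2 (Or.inr ⟨rfl, rfl⟩))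
    · rw [heckeFactor_boxOp_apply_of_not _ fun p hc hp => h ⟨p, hc, hp⟩, ← ih hL2]
      refine finsum_mem_congr (Set.ext fun T => ⟨fun hT => ?_, fun hT => IsTableau.cons hT⟩)
        fun _ _ => rfl
      have hT : IsTableau r ((a, c) :: L) lam mu T := hT
      refine hT.mono fun q d hd => ?_
      rcases List.mem_cons.1 (hT.steps q d hd) with h' | h'
      · obtain ⟨rfl, h2⟩ : d = a ∧ content q = c := Prod.mk.inj h'
        exact absurd ⟨q, h2, hT.isCorner hL1 hd h2⟩ h
      · exact h'

end

/-! ### Extraction of coefficients -/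

open Classical in
/-- All steps with letters from a decreasing list and contents of absolute value at most `N`, in the
order required for building tableaux (the last step first). -/
noncomputable def steps {α : Type} (r : α → Prop) (N : ℕ) (l : List α) : List (α × ℤ) :=
  l.flatMap fun a => (if r a then (contentList (-N) (2 * N + 1)).reverse
    else contentList (-N) (2 * N + 1)).map (Prod.mk a)

open Classical in
theorem stepsOp_steps {α : Type} {R : Type*} [CommRing R] (b : R) (x : α → R) (r : α → Prop) (N : ℕ)
    (l : List α) : stepsOp b x (steps r N l) = (l.map fun a =>
      if r a then descProd (boxOp b) (-N) (2 * N + 1) (x a)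
      else ascProd (boxOp b) (-N) (2 * N + 1) (x a)).prod := by
  induction l with
  | nil => rfl
  | cons a l ih =>
    rw [List.map_cons, List.prod_cons, ← ih]
    simp only [stepsOp, steps, List.flatMap_cons, List.map_append, List.prod_append]
    congr 1
    split_ifs <;> simp [descProd, ascProd, Function.comp_def]

theorem mem_steps {α : Type} {r : α → Prop} {N : ℕ} {l : List α} {a : α} {c : ℤ} :
    (a, c) ∈ steps r N l ↔ a ∈ l ∧ -(N : ℤ) ≤ c ∧ c ≤ N := by
  classical
  simp only [steps, List.mem_flatMap, List.mem_map, Prod.mk.injEq]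
  have : ∀ b c, c ∈ (if r b then (contentList (-N) (2 * N + 1)).reverse
      else contentList (-N) (2 * N + 1)) ↔ -(N : ℤ) ≤ c ∧ c ≤ N := by
    intro b c
    split_ifs <;> simp only [List.mem_reverse, mem_contentList] <;> push_cast <;> omega
  constructor
  · rintro ⟨b, hb, d, hd, rfl, rfl⟩
    exact ⟨hb, (this _ _).1 hd⟩
  · rintro ⟨h1, h2⟩
    exact ⟨a, h1, c, (this _ _).2 h2, rfl, rfl⟩

theorem pairwise_steps {α : Type} [LinearOrder α] (r : α → Prop) (N : ℕ) {l : List α}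
    (hl : l.Pairwise (· > ·)) : (steps r N l).Pairwise fun s t => StepLT r t s := by
  classical
  rw [steps, List.pairwise_flatMap]
  refine ⟨fun a _ => ?_, hl.imp fun {a b} hab => ?_⟩
  · rw [List.pairwise_map]
    split_ifs with h
    · rw [List.pairwise_reverse]
      exact (pairwise_contentList _ _).imp fun h' => Or.inr ⟨rfl, Or.inl ⟨h, h'⟩⟩
    · exact (pairwise_contentList _ _).imp fun h' => Or.inr ⟨rfl, Or.inr ⟨h, h'⟩⟩
  · intro s hs t ht
    obtain ⟨_, _, rfl⟩ := List.mem_map.1 hs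
    obtain ⟨_, _, rfl⟩ := List.mem_map.1 ht
    exact Or.inl hab

/-- A bound for the coordinates of the boxes of `lam`. -/
def coordBound (lam : YoungDiagram) : ℕ := ∑ p ∈ lam.cells, (p.1 + p.2)

theorem abs_content_le {lam : YoungDiagram} {p : ℕ × ℕ} (hp : p ∈ lam) :
    -(coordBound lam : ℤ) ≤ content p ∧ content p ≤ coordBound lam := by
  have : p.1 + p.2 ≤ coordBound lam :=
    Finset.single_le_sum (f := fun p : ℕ × ℕ => p.1 + p.2) (fun _ _ => Nat.zero_le _) hp
  simp only [content]
  omega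

theorem prod_monomial {ι σ S : Type*} [CommRing S] (s : Finset ι) (f : ι → σ →₀ ℕ) :
    ∏ i ∈ s, MvPowerSeries.monomial (f i) (1 : S) = MvPowerSeries.monomial (∑ i ∈ s, f i) 1 := by
  classical
  induction s using Finset.induction_on with
  | empty => simp
  | insert a s ha ih =>
    rw [Finset.prod_insert ha, Finset.sum_insert ha, ih, MvPowerSeries.monomial_mul_monomial, one_mul]

theorem tabTerm_eq_monomial {α S : Type} [CommRing S] [Algebra ℝ S] (β : ℝ) (idx : α → ℕ+)
    (E : Finset (ℕ × ℕ)) (N : ℕ) (T : Filling α) :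
    tabTerm (algebraMap ℝ (MvPowerSeries ℕ+ S) β) (fun a => MvPowerSeries.X (idx a)) E N T =
      MvPowerSeries.monomial (weight idx E T) (algebraMap ℝ S (β ^ (size E T - N))) := by
  simp only [tabTerm, MvPowerSeries.X, weight, prod_monomial]
  rw [← map_pow, MvPowerSeries.algebraMap_apply, ← MvPowerSeries.monomial_zero_eq_C_apply,
    MvPowerSeries.monomial_mul_monomial, zero_add, mul_one]

theorem mem_support_of_weight_eq {α : Type} {idx : α → ℕ+} {E : Finset (ℕ × ℕ)} {T : Filling α}
    {m : ℕ+ →₀ ℕ} (hw : weight idx E T = m) {p : ℕ × ℕ} (hp : p ∈ E) {a : α} (ha : a ∈ T p) :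
    idx a ∈ m.support := by
  rw [← hw, Finsupp.mem_support_iff]
  simp only [weight, Finsupp.finsetSum_apply]
  intro h
  have := Finset.sum_eq_zero_iff.1 (Finset.sum_eq_zero_iff.1 h p hp) a ha
  simp at this

/-- The coefficients of a tableau series, as coefficients of entries of the operators. -/
theorem coeff_stepsOp {α S : Type} [LinearOrder α] [CommRing S] [Algebra ℝ S] (β : ℝ) (idx : α → ℕ+)
    {r : α → Prop} {L : List (α × ℤ)} (hL : L.Pairwise fun s t => StepLT r t s)
    (lam mu : YoungDiagram) (m : ℕ+ →₀ ℕ) (A : Set (Filling α))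
    (hA : ∀ T, weight idx lam.cells T = m → (T ∈ A ↔ IsTableau r L lam mu T)) :
    MvPowerSeries.coeff m (stepsOp (algebraMap ℝ (MvPowerSeries ℕ+ S) β)
      (fun a => MvPowerSeries.X (idx a)) L (delta _ mu) lam) =
    algebraMap ℝ S (tableauSeries idx β lam.cells (lam.card - mu.card) A m) := by
  classical
  have e : {T | T ∈ A ∧ weight idx lam.cells T = m} =
      {T | IsTableau r L lam mu T ∧ weight idx lam.cells T = m} :=
    Set.ext fun T => and_congr_left (hA T)
  have hf := finite_isTableau r L lam mu
  rw [← finsum_tabTerm _ _ hL, tableauSeries, e]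
  have h1 := (MvPowerSeries.coeff (R := S) m).toAddMonoidHom.map_finsum_mem
    (tabTerm (algebraMap ℝ (MvPowerSeries ℕ+ S) β) (fun a => MvPowerSeries.X (idx a)) lam.cells
      (lam.card - mu.card)) hf
  have h2 := (algebraMap ℝ S).toAddMonoidHom.map_finsum_mem
    (fun T : Filling α => β ^ (size lam.cells T - (lam.card - mu.card)))
    (s := {T | IsTableau r L lam mu T ∧ weight idx lam.cells T = m}) (hf.subset fun T hT => hT.1)
  refine h1.trans (Eq.trans ?_ h2.symm)
  rw [finsum_mem_def, finsum_mem_def]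
  congr 1
  funext T
  simp only [Set.indicator, Set.mem_ofPred_eq, LinearMap.toAddMonoidHom_coe, tabTerm_eq_monomial,
    MvPowerSeries.coeff_monomial, eq_comm (a := m), RingHom.toAddMonoidHom_eq_coe, AddMonoidHom.coe_coe]
  by_cases h1 : IsTableau r L lam mu T <;> by_cases h2 : weight idx lam.cells T = m <;>
    simp [h1, h2]

/-- The positive integers `M, …, 2, 1`. -/
def letterList (M : ℕ) : List ℕ+ := ((List.range M).map Nat.succPNat).reverse

theorem mem_letterList {M : ℕ} {n : ℕ+} : n ∈ letterList M ↔ (n : ℕ) ≤ M := by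
  simp only [letterList, List.mem_reverse, List.mem_map, List.mem_range]
  constructor
  · rintro ⟨k, hk, rfl⟩; exact hk
  · intro h
    exact ⟨n.natPred, by have := n.natPred_add_one; omega, n.succPNat_natPred⟩

theorem pairwise_letterList (M : ℕ) : (letterList M).Pairwise (· > ·) := by
  rw [letterList, List.pairwise_reverse, List.pairwise_map]
  exact List.pairwise_lt_range.imp fun h => Nat.succPNat_lt_succPNat.2 h

/-- A bound for the letters occurring in a monomial. -/
def letterBound (m : ℕ+ →₀ ℕ) : ℕ := ∑ n ∈ m.support, (n : ℕ)

theorem le_letterBound {m : ℕ+ →₀ ℕ} {n : ℕ+} (h : n ∈ m.support) : (n : ℕ) ≤ letterBound m :=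
  Finset.single_le_sum (f := fun n : ℕ+ => (n : ℕ)) (fun _ _ => Nat.zero_le _) h

theorem coeff_stepsOp_eq_coeff_skewG {S : Type} [CommRing S] [Algebra ℝ S] (β : ℝ)
    {kap lam mu : YoungDiagram} {N M : ℕ} {m : ℕ+ →₀ ℕ} (hN : coordBound kap = N) (hk : lam ≤ kap)
    (hM : letterBound m ≤ M) (h : mu ≤ lam) :
    MvPowerSeries.coeff m (stepsOp (algebraMap ℝ (MvPowerSeries ℕ+ S) β)
      (fun a => MvPowerSeries.X a) (steps (fun _ => True) N (letterList M)) (delta _ mu) lam) =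
    algebraMap ℝ S (MvPowerSeries.coeff m (skewG β lam mu)) := by
  refine coeff_stepsOp β id (pairwise_steps _ N (pairwise_letterList M)) lam mu m _ fun T hw => ?_
  constructor
  · rintro ⟨h1, h2⟩
    refine ⟨h, h1, fun _ _ _ _ _ => trivial,
      fun i j a ha ha' => absurd ha' (Finset.disjoint_left.1 (h2 i j) ha), fun p a ha => ?_⟩
    have hp : p ∈ lam.cells \ interior mu.cells := by
      by_contra h
      simp [h1.empty_outside p h] at ha
    have hp := (Finset.mem_sdiff.1 hp).1
    rw [mem_steps, mem_letterList, ← hN]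
    exact ⟨(le_letterBound (mem_support_of_weight_eq hw hp ha)).trans hM, abs_content_le (hk hp)⟩
  · intro hT
    exact ⟨hT.isSetValued, fun i j => Finset.disjoint_left.2 fun a ha ha' =>
      hT.col i j a ha ha' trivial⟩

theorem exists_formal_neg {R : Type*} [CommRing R] {b x : R} (h : IsUnit (1 + b * x)) :
    ∃ x', x + x' + b * x * x' = 0 := by
  obtain ⟨u, hu⟩ := h
  refine ⟨-(x * ↑u⁻¹), ?_⟩
  have : (1 + b * x) * ↑u⁻¹ = 1 := by rw [← hu]; simp
  linear_combination (-x) * this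

theorem exists_formal_neg_X {S : Type} [CommRing S] [Algebra ℝ S] (β : ℝ) (n : ℕ+) :
    ∃ x', (MvPowerSeries.X n : MvPowerSeries ℕ+ S) + x' +
      algebraMap ℝ (MvPowerSeries ℕ+ S) β * MvPowerSeries.X n * x' = 0 := by
  refine exists_formal_neg ?_
  rw [MvPowerSeries.isUnit_iff_constantCoeff]
  simp

/-- Symmetry of `G_lam(x, y)` in the two alphabets, on the level of coefficients. The
partition `nu` is the shape filled by the letters of the alphabet that comes first. -/
theorem sum_coeff_skewG_mul_coeff_G_comm (β : ℝ) (lam : YoungDiagram) (m m' : ℕ+ →₀ ℕ) :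
    ∑ nu ∈ below lam, MvPowerSeries.coeff m (G β nu) * MvPowerSeries.coeff m' (skewG β lam nu) =
    ∑ nu ∈ below lam, MvPowerSeries.coeff m' (G β nu) * MvPowerSeries.coeff m (skewG β lam nu) := by
  let S := MvPowerSeries ℕ+ ℝ
  let K := MvPowerSeries ℕ+ S
  set M := max (letterBound m) (letterBound m') with hM
  set L := steps (fun _ : ℕ+ => True) (coordBound lam) (letterList M) with hL
  let X : ℕ+ → K := fun a => MvPowerSeries.X a
  let Y : ℕ+ → K := fun a => MvPowerSeries.C (MvPowerSeries.X a : S)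
  let b : K := algebraMap ℝ K β
  have hb : b = MvPowerSeries.C (algebraMap ℝ S β) := MvPowerSeries.algebraMap_apply ..
  have hC : ∀ t : ℝ, algebraMap ℝ S t = MvPowerSeries.C t := fun t =>
    MvPowerSeries.algebraMap_apply ..
  have hcomm : stepsOp b X L * stepsOp b Y L = stepsOp b Y L * stepsOp b X L := by
    rw [hL, stepsOp_steps, stepsOp_steps]
    refine (Commute.list_prod_left _ _ fun P hP => Commute.list_prod_right _ _ fun Q hQ => ?_).eq
    obtain ⟨i, -, rfl⟩ := List.mem_map.1 hP
    obtain ⟨j, -, rfl⟩ := List.mem_map.1 hQ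
    simp only [if_true]
    obtain ⟨x', hx'⟩ := exists_formal_neg_X (S := S) β i
    exact isHeckeFamily_boxOp.commute_descProd hx' _ _ _
  have hY : ∀ nu kap, stepsOp b Y L (delta K nu) kap =
      MvPowerSeries.C (stepsOp (algebraMap ℝ S β) (fun a => (MvPowerSeries.X a : S)) L
        (delta S nu) kap) := by
    intro nu kap
    rw [← stepsOp_map, ← hb, map_delta]
  have h1 : ∀ nu ∈ below lam, MvPowerSeries.coeff m' (stepsOp b X L (delta K nu) lam) =
      algebraMap ℝ S (MvPowerSeries.coeff m' (skewG β lam nu)) := fun nu hnu =>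
    coeff_stepsOp_eq_coeff_skewG β rfl le_rfl (le_max_right _ _) (mem_below.1 hnu)
  have h2 : ∀ nu ∈ below lam, MvPowerSeries.coeff m' (stepsOp b X L (delta K ⊥) nu) =
      algebraMap ℝ S (MvPowerSeries.coeff m' (G β nu)) := fun nu hnu =>
    coeff_stepsOp_eq_coeff_skewG β rfl (mem_below.1 hnu) (le_max_right _ _) bot_le
  have h3 : ∀ nu ∈ below lam, MvPowerSeries.coeff m (stepsOp (algebraMap ℝ S β)
      (fun a => (MvPowerSeries.X a : S)) L (delta S nu) lam) =
      MvPowerSeries.coeff m (skewG β lam nu) := fun nu hnu =>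
    coeff_stepsOp_eq_coeff_skewG β rfl le_rfl (le_max_left _ _) (mem_below.1 hnu)
  have h4 : ∀ nu ∈ below lam, MvPowerSeries.coeff m (stepsOp (algebraMap ℝ S β)
      (fun a => (MvPowerSeries.X a : S)) L (delta S ⊥) nu) =
      MvPowerSeries.coeff m (G β nu) := fun nu hnu =>
    coeff_stepsOp_eq_coeff_skewG β rfl (mem_below.1 hnu) (le_max_left _ _) bot_le
  have key := congrArg (fun P : Module.End K (YoungDiagram → K) =>
    MvPowerSeries.coeff m (MvPowerSeries.coeff m' (P (delta K ⊥) lam))) hcomm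
  simp only [Module.End.mul_apply] at key
  rw [stepsOp_expand, stepsOp_expand (x := Y)] at key
  simp only [map_sum] at key
  calc _ = _ := Finset.sum_congr rfl fun nu hnu => ?_
    _ = _ := key
    _ = _ := Finset.sum_congr rfl fun nu hnu => ?_
  · rw [hY, MvPowerSeries.coeff_C_mul, h1 nu hnu, hC (MvPowerSeries.coeff m' _),
      MvPowerSeries.coeff_mul_C, h4 nu hnu]
  · rw [hY, MvPowerSeries.coeff_mul_C, h2 nu hnu, hC (MvPowerSeries.coeff m' _),
      MvPowerSeries.coeff_C_mul, h3 nu hnu]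

/-! ### Triangularity, linear independence and spanning -/

/-- The sum of the row numbers (counted from `1`) of all boxes. -/
def rowSum (lam : YoungDiagram) : ℕ := ∑ p ∈ lam.cells, (p.1 + 1)

/-- The exponent vector `lam`, that is, the weight of the tableau with entries `i` in row `i`. -/
noncomputable def rowExponent (lam : YoungDiagram) : ℕ+ →₀ ℕ :=
  ∑ p ∈ lam.cells, Finsupp.single (Nat.succPNat p.1) 1

theorem rowExponent_apply (lam : YoungDiagram) (i : ℕ) :
    rowExponent lam (Nat.succPNat i) = lam.rowLen i := by
  rw [YoungDiagram.rowLen_eq_card, rowExponent, Finsupp.finsetSum_apply, YoungDiagram.row,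
    Finset.card_filter]
  refine Finset.sum_congr rfl fun p _ => ?_
  rw [Finsupp.single_apply]
  congr 1
  exact propext Nat.succPNat_injective.eq_iff

theorem rowExponent_injective {lam mu : YoungDiagram} (h : rowExponent lam = rowExponent mu) :
    lam = mu := by
  ext ⟨i, j⟩
  rw [YoungDiagram.mem_cells, YoungDiagram.mem_cells, YoungDiagram.mem_iff_lt_rowLen,
    YoungDiagram.mem_iff_lt_rowLen, ← rowExponent_apply, h, rowExponent_apply]

theorem weightSum_eq (E : Finset (ℕ × ℕ)) (T : Filling ℕ+) :
    Finsupp.weight (fun n : ℕ+ => (n : ℕ)) (weight id E T) = ∑ p ∈ E, ∑ a ∈ T p, (a : ℕ) := by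
  simp [weight, map_sum, Finsupp.weight_single]

theorem weightSum_rowExponent (lam : YoungDiagram) :
    Finsupp.weight (fun n : ℕ+ => (n : ℕ)) (rowExponent lam) = rowSum lam := by
  simp [rowExponent, rowSum, map_sum, Finsupp.weight_single]

theorem SVT_bot_nonempty {lam : YoungDiagram} {T : Filling ℕ+} (hT : T ∈ SVT lam ⊥) {p : ℕ × ℕ}
    (hp : p ∈ lam) : (T p).Nonempty :=
  hT.1.nonempty p (by simpa using hp)

theorem SVT_bot_eq_empty {lam : YoungDiagram} {T : Filling ℕ+} (hT : T ∈ SVT lam ⊥) {p : ℕ × ℕ}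
    (hp : p ∉ lam) : T p = ∅ :=
  hT.1.empty_outside p (by simp [hp])

/-- Entries in row `i` are at least `i`, as columns increase strictly. -/
theorem le_of_mem_SVT {lam : YoungDiagram} {T : Filling ℕ+} (hT : T ∈ SVT lam ⊥) (i j : ℕ) {a : ℕ+}
    (ha : a ∈ T (i, j)) : i + 1 ≤ (a : ℕ) := by
  induction i generalizing a with
  | zero => exact a.pos
  | succ i ih =>
    have hp : (i + 1, j) ∈ lam := by
      by_contra h
      simp [SVT_bot_eq_empty hT h] at ha
    obtain ⟨d, hd⟩ := SVT_bot_nonempty hT (mem_of_le hp (p := (i, j)) (by simp) le_rfl)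
    have h1 := ih hd
    have h2 : d ≤ a := hT.1.col_le i j d hd a ha
    have h3 : d ≠ a := fun e => Finset.disjoint_left.1 (hT.2 i j) hd (e ▸ ha)
    have h4 : (d : ℕ) < a := PNat.coe_lt_coe _ _ |>.2 (lt_of_le_of_ne h2 h3)
    omega

theorem row_le_sum {lam : YoungDiagram} {T : Filling ℕ+} (hT : T ∈ SVT lam ⊥) {p : ℕ × ℕ}
    (hp : p ∈ lam.cells) : p.1 + 1 ≤ ∑ a ∈ T p, (a : ℕ) := by
  obtain ⟨a, ha⟩ := SVT_bot_nonempty hT hp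
  exact (le_of_mem_SVT hT p.1 p.2 ha).trans
    (Finset.single_le_sum (f := fun a : ℕ+ => (a : ℕ)) (fun _ _ => Nat.zero_le _) ha)

theorem rowSum_le_of_weight_eq {lam mu : YoungDiagram} {T : Filling ℕ+} (hT : T ∈ SVT lam ⊥)
    (hw : weight id lam.cells T = rowExponent mu) : rowSum lam ≤ rowSum mu := by
  rw [← weightSum_rowExponent mu, ← hw, weightSum_eq]
  exact Finset.sum_le_sum fun p hp => row_le_sum hT hp

theorem eq_singleton_of_weight_eq {lam mu : YoungDiagram} {T : Filling ℕ+} (hT : T ∈ SVT lam ⊥)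
    (hw : weight id lam.cells T = rowExponent mu) (h : rowSum mu ≤ rowSum lam) {p : ℕ × ℕ}
    (hp : p ∈ lam) : T p = {Nat.succPNat p.1} := by
  have h1 : ∑ p ∈ lam.cells, (p.1 + 1) = ∑ p ∈ lam.cells, ∑ a ∈ T p, (a : ℕ) := by
    refine le_antisymm (Finset.sum_le_sum fun p hp => row_le_sum hT hp) ?_
    rwa [← weightSum_eq, hw, weightSum_rowExponent]
  have h2 := (Finset.sum_eq_sum_iff_of_le fun p hp => row_le_sum hT hp).1 h1 p hp
  have h3 : ∀ a ∈ T p, a = Nat.succPNat p.1 := fun a ha => by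
    have h4 := le_of_mem_SVT hT p.1 p.2 ha
    have h5 := Finset.single_le_sum (f := fun a : ℕ+ => (a : ℕ)) (fun _ _ => Nat.zero_le _) ha
    rw [← h2] at h5
    exact PNat.coe_injective (le_antisymm h5 h4)
  exact Finset.eq_singleton_iff_nonempty_unique_mem.2 ⟨SVT_bot_nonempty hT hp, h3⟩

theorem weight_eq_rowExponent {lam : YoungDiagram} {T : Filling ℕ+}
    (h : ∀ p ∈ lam, T p = {Nat.succPNat p.1}) : weight id lam.cells T = rowExponent lam :=
  Finset.sum_congr rfl fun p hp => by rw [h p hp]; simp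

theorem coeff_G (β : ℝ) (lam : YoungDiagram) (m : ℕ+ →₀ ℕ) : MvPowerSeries.coeff m (G β lam) =
    ∑ᶠ T ∈ {T | T ∈ SVT lam ⊥ ∧ weight id lam.cells T = m}, β ^ (size lam.cells T - lam.card) := by
  have : (⊥ : YoungDiagram).card = 0 := rfl
  change ∑ᶠ T ∈ {T | T ∈ SVT lam ⊥ ∧ weight id lam.cells T = m},
    β ^ (size lam.cells T - (lam.card - (⊥ : YoungDiagram).card)) = _
  rw [this, Nat.sub_zero]

theorem coeff_rowExponent_G_of_ne (β : ℝ) {lam mu : YoungDiagram}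
    (h : MvPowerSeries.coeff (rowExponent mu) (G β lam) ≠ 0) : lam = mu ∨ rowSum lam < rowSum mu := by
  rw [coeff_G] at h
  obtain ⟨T, hT, -⟩ := exists_ne_zero_of_finsum_mem_ne_zero h
  rcases (rowSum_le_of_weight_eq hT.1 hT.2).lt_or_eq with h1 | h1
  · exact Or.inr h1
  · exact Or.inl (rowExponent_injective ((weight_eq_rowExponent fun p hp =>
      eq_singleton_of_weight_eq hT.1 hT.2 h1.ge hp).symm.trans hT.2))

theorem coeff_rowExponent_G_self (β : ℝ) (lam : YoungDiagram) :
    MvPowerSeries.coeff (rowExponent lam) (G β lam) = 1 := by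
  classical
  set T₀ : Filling ℕ+ := fun p => if p ∈ lam then {Nat.succPNat p.1} else ∅ with hT₀
  have hmem : ∀ p a, a ∈ T₀ p ↔ p ∈ lam ∧ a = Nat.succPNat p.1 := by
    intro p a
    simp only [hT₀]
    split_ifs with h <;> simp [h]
  have h0 : ∀ p ∈ lam, T₀ p = {Nat.succPNat p.1} := fun p hp => if_pos hp
  have h1 : T₀ ∈ SVT lam ⊥ := by
    refine ⟨⟨fun p hp => if_neg fun h => hp (by simpa [interior] using h), fun p hp => ?_, ?_, ?_⟩, ?_⟩
    · rw [h0 p (Finset.mem_sdiff.1 hp).1]; exact Finset.singleton_nonempty _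
    · intro i j a ha d hd
      rw [((hmem _ _).1 ha).2, ((hmem _ _).1 hd).2]
    · intro i j a ha d hd
      rw [((hmem _ _).1 ha).2, ((hmem _ _).1 hd).2]
      exact Nat.succPNat_le_succPNat.2 (Nat.le_succ i)
    · intro i j
      refine Finset.disjoint_left.2 fun a ha hd => ?_
      have := Nat.succPNat_injective (((hmem _ _).1 ha).2.symm.trans ((hmem _ _).1 hd).2)
      simp at this
  have e : {T | T ∈ SVT lam ⊥ ∧ weight id lam.cells T = rowExponent lam} = {T₀} := by
    refine Set.eq_singleton_iff_unique_mem.2 ⟨⟨h1, weight_eq_rowExponent h0⟩, fun T hT => funext fun p => ?_⟩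
    by_cases hp : p ∈ lam
    · rw [h0 p hp, eq_singleton_of_weight_eq hT.1 hT.2 le_rfl hp]
    · rw [SVT_bot_eq_empty hT.1 hp, SVT_bot_eq_empty h1 hp]
  have hs : size lam.cells T₀ = lam.card := by
    rw [size, Finset.sum_congr rfl fun p hp => by rw [h0 p hp]]
    simp
  rw [coeff_G, e, finsum_mem_singleton, hs, Nat.sub_self, pow_zero]

theorem linearIndependent_G (β : ℝ) : LinearIndependent ℝ (G β) := by
  classical
  rw [linearIndependent_iff']
  intro s g hg lam hlam
  by_contra hne
  -- Look at the coefficient of `x^mu` for `mu` with nonzero coefficient and `rowSum mu` minimal.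
  obtain ⟨mu, hmu, hmin⟩ := Finset.exists_min_image (s.filter fun nu => g nu ≠ 0) rowSum
    ⟨lam, Finset.mem_filter.2 ⟨hlam, hne⟩⟩
  have h := congrArg (MvPowerSeries.coeff (rowExponent mu)) hg
  rw [map_sum, Finset.sum_eq_single mu] at h
  · rw [map_smul, coeff_rowExponent_G_self, map_zero, smul_eq_mul, mul_one] at h
    exact (Finset.mem_filter.1 hmu).2 h
  · intro nu hnu hnm
    rw [map_smul, smul_eq_mul]
    by_contra h0
    obtain ⟨h1, h2⟩ := mul_ne_zero_iff.1 h0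
    rcases coeff_rowExponent_G_of_ne β h2 with h3 | h3
    · exact hnm h3
    · exact absurd (hmin nu (Finset.mem_filter.2 ⟨hnu, h1⟩)) (not_le.2 h3)
  · exact fun h' => absurd (Finset.mem_filter.1 hmu).1 h'

/-- The symmetry of `G_lam(x, y)`, read as an identity of power series in one alphabet. -/
theorem sum_coeff_G_smul_skewG (β : ℝ) (lam : YoungDiagram) (m : ℕ+ →₀ ℕ) :
    ∑ nu ∈ below lam, MvPowerSeries.coeff m (G β nu) • skewG β lam nu =
    ∑ nu ∈ below lam, MvPowerSeries.coeff m (skewG β lam nu) • G β nu := by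
  ext m'
  simp only [map_sum, map_smul, smul_eq_mul]
  rw [sum_coeff_skewG_mul_coeff_G_comm]
  exact Finset.sum_congr rfl fun nu _ => mul_comm _ _

theorem skewG_mem_span (β : ℝ) (lam mu : YoungDiagram) (h : mu ≤ lam) :
    skewG β lam mu ∈ Submodule.span ℝ (Set.range (G β)) := by
  classical
  induction hn : rowSum mu using Nat.strong_induction_on generalizing mu with
  | _ n ih =>
    have key := sum_coeff_G_smul_skewG β lam (rowExponent mu)
    rw [← Finset.add_sum_erase _ _ (mem_below.2 h), coeff_rowExponent_G_self, one_smul] at key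
    rw [eq_sub_of_add_eq key]
    refine Submodule.sub_mem _ (Submodule.sum_mem _ fun nu _ => Submodule.smul_mem _ _
      (Submodule.subset_span ⟨nu, rfl⟩)) (Submodule.sum_mem _ fun nu hnu => ?_)
    obtain ⟨h1, h2⟩ := Finset.mem_erase.1 hnu
    by_cases h0 : MvPowerSeries.coeff (rowExponent mu) (G β nu) = 0
    · rw [h0, zero_smul]; exact Submodule.zero_mem _
    · refine Submodule.smul_mem _ _ (ih _ ?_ nu (mem_below.1 h2) rfl)
      rw [← hn]
      exact (coeff_rowExponent_G_of_ne β h0).resolve_left h1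

theorem linearIndependent_GElt (β : ℝ) : LinearIndependent ℝ (GElt β) :=
  LinearIndependent.of_comp (Gamma β).subtype (linearIndependent_G β)

theorem top_le_span_GElt (β : ℝ) : ⊤ ≤ Submodule.span ℝ (Set.range (GElt β)) := by
  have h : Submodule.map (Gamma β).subtype (Submodule.span ℝ (Set.range (GElt β))) =
      Submodule.span ℝ (Set.range (G β)) := by
    rw [Submodule.map_span, ← Set.range_comp]
    rfl
  rintro ⟨f, hf⟩ -
  have hf' : f ∈ Submodule.span ℝ (Set.range (G β)) := by
    refine (Submodule.span_le.2 ?_) hf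
    rintro _ ⟨lam, mu, hle, rfl⟩
    exact skewG_mem_span β lam mu hle
  rw [← h] at hf'
  obtain ⟨g, hg, hgf⟩ := hf'
  have : g = ⟨f, hf⟩ := Subtype.ext hgf
  rwa [← this]

/-- The basis of `Γ^(β)` formed by the symmetric Grothendieck functions. -/
noncomputable def basisG (β : ℝ) : Module.Basis YoungDiagram ℝ (Gamma β) :=
  Module.Basis.mk (linearIndependent_GElt β) (top_le_span_GElt β)

theorem basisG_apply (β : ℝ) (lam : YoungDiagram) : basisG β lam = GElt β lam :=
  Module.Basis.mk_apply _ _ _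

/-! ### Shifted tableaux of shape `(lam + δ) / δ` -/

theorem mem_ofRows {n : ℕ} {f : ℕ → ℕ} {hf : Antitone f} {i j : ℕ} :
    (i, j) ∈ ofRows n f hf ↔ i < n ∧ j < f i := by
  change (i, j) ∈ Finset.map _ _ ↔ _
  simp only [Finset.mem_map, Finset.mem_sigma, Finset.mem_range]
  constructor
  · rintro ⟨⟨a, b⟩, h, e⟩
    obtain ⟨rfl, rfl⟩ := Prod.mk.inj e
    exact h
  · exact fun h => ⟨⟨i, j⟩, h, rfl⟩

theorem mem_shiftedCells {lam : YoungDiagram} {i k : ℕ} :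
    (i, k) ∈ shiftedCells lam ↔ i ≤ k ∧ (i, k - i) ∈ lam := by
  simp only [shiftedCells, Finset.mem_image, YoungDiagram.mem_cells, Prod.mk.injEq, Prod.exists]
  constructor
  · rintro ⟨a, b, h, rfl, rfl⟩
    exact ⟨Nat.le_add_right _ _, by simpa using h⟩
  · rintro ⟨h1, h2⟩
    exact ⟨i, k - i, h2, rfl, by omega⟩

theorem card_shiftedCells (lam : YoungDiagram) : (shiftedCells lam).card = lam.card := by
  refine Finset.card_image_of_injective _ fun p q h => ?_
  obtain ⟨h1, h2⟩ := Prod.mk.inj h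
  exact Prod.ext h1 (by omega)

theorem lt_numParts {lam : YoungDiagram} {i j : ℕ} (h : (i, j) ∈ lam) : i < numParts lam :=
  YoungDiagram.mem_iff_lt_colLen.1 (mem_of_le h (p := (i, 0)) le_rfl (Nat.zero_le _))

theorem mem_staircase {n i j : ℕ} : (i, j) ∈ staircase n ↔ i < n ∧ j < n - i := mem_ofRows

theorem mem_addStaircase {lam : YoungDiagram} {i j : ℕ} : (i, j) ∈ addStaircase lam ↔
    i < numParts lam ∧ j < lam.rowLen i + (numParts lam - i) := mem_ofRows

theorem mem_shiftedCells_staircase {n i k : ℕ} :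
    (i, k) ∈ shiftedCells (staircase n) ↔ i ≤ k ∧ k < n := by
  rw [mem_shiftedCells, mem_staircase]; omega

theorem mem_shiftedCells_addStaircase {lam : YoungDiagram} {i k : ℕ} :
    (i, k) ∈ shiftedCells (addStaircase lam) ↔ (i, k) ∈ shiftedCells (staircase (numParts lam)) ∨
      numParts lam ≤ k ∧ (i, k - numParts lam) ∈ lam := by
  rw [mem_shiftedCells_staircase, mem_shiftedCells, mem_addStaircase]
  constructor
  · rintro ⟨h1, h2, h3⟩
    by_cases h : k < numParts lam
    · exact Or.inl ⟨h1, h⟩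
    · exact Or.inr ⟨by omega, YoungDiagram.mem_iff_lt_rowLen.2 (by omega)⟩
  · rintro (⟨h1, h2⟩ | ⟨h1, h2⟩)
    · exact ⟨h1, by omega, by omega⟩
    · have h3 := lt_numParts h2
      have h4 := YoungDiagram.mem_iff_lt_rowLen.1 h2
      exact ⟨by omega, h3, by omega⟩

/-- Translation by `n` columns to the right. -/
def shiftRight (n : ℕ) (p : ℕ × ℕ) : ℕ × ℕ := (p.1, p.2 + n)

theorem shiftRight_injective (n : ℕ) : Function.Injective (shiftRight n) := fun p q h => by
  obtain ⟨h1, h2⟩ := Prod.mk.inj h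
  exact Prod.ext h1 (by omega)

/-- The skew shifted diagram of `(lam + δ) / δ` is a translate of the unshifted diagram of `lam`. -/
theorem shiftedCells_addStaircase (lam : YoungDiagram) :
    shiftedCells (addStaircase lam) = shiftedCells (staircase (numParts lam)) ∪
      lam.cells.image (shiftRight (numParts lam)) := by
  ext ⟨i, k⟩
  rw [mem_shiftedCells_addStaircase, Finset.mem_union]
  refine or_congr_right ⟨fun h => Finset.mem_image.2 ⟨_, h.2, Prod.ext rfl (Nat.sub_add_cancel h.1)⟩, ?_⟩
  intro h
  obtain ⟨⟨a, b⟩, h1, h2⟩ := Finset.mem_image.1 h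
  obtain ⟨rfl, rfl⟩ := Prod.mk.inj h2
  exact ⟨Nat.le_add_left _ _, by simpa using h1⟩

theorem disjoint_staircase (lam : YoungDiagram) :
    Disjoint (shiftedCells (staircase (numParts lam)))
      (lam.cells.image (shiftRight (numParts lam))) := by
  refine Finset.disjoint_left.2 ?_
  rintro ⟨i, k⟩ h1 h2
  obtain ⟨⟨a, b⟩, -, h3⟩ := Finset.mem_image.1 h2
  obtain ⟨rfl, rfl⟩ := Prod.mk.inj h3
  have := (mem_shiftedCells_staircase.1 h1).2
  omega

theorem card_addStaircase (lam : YoungDiagram) :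
    (addStaircase lam).card - (staircase (numParts lam)).card = lam.card - (⊥ : YoungDiagram).card := by
  have h0 : (⊥ : YoungDiagram).card = 0 := rfl
  rw [← card_shiftedCells, shiftedCells_addStaircase, Finset.card_union_of_disjoint
    (disjoint_staircase lam), Finset.card_image_of_injective _ (shiftRight_injective _),
    card_shiftedCells, h0]
  simp

/-- The filling of a diagram translated by `n` columns. -/
def shiftFilling {α : Type} (n : ℕ) (T : Filling α) : Filling α :=
  fun p => if n ≤ p.2 then T (p.1, p.2 - n) else ∅

theorem shiftFilling_shiftRight {α : Type} (n : ℕ) (T : Filling α) (p : ℕ × ℕ) :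
    shiftFilling n T (shiftRight n p) = T p := by
  simp [shiftFilling, shiftRight]

theorem shiftFilling_of_lt {α : Type} {n : ℕ} (T : Filling α) {p : ℕ × ℕ} (h : p.2 < n) :
    shiftFilling n T p = ∅ := if_neg (not_le.2 h)

theorem sum_shiftFilling {α : Type} {A : Type*} [AddCommMonoid A] (g : Finset α → A) (hg : g ∅ = 0)
    (lam : YoungDiagram) (T : Filling α) :
    ∑ p ∈ shiftedCells (addStaircase lam), g (shiftFilling (numParts lam) T p) =
      ∑ p ∈ lam.cells, g (T p) := by
  rw [shiftedCells_addStaircase, Finset.sum_union (disjoint_staircase lam), Finset.sum_eq_zero,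
    zero_add, Finset.sum_image (shiftRight_injective _).injOn]
  · exact Finset.sum_congr rfl fun p _ => by rw [shiftFilling_shiftRight]
  · rintro ⟨i, k⟩ h
    rw [shiftFilling_of_lt T (mem_shiftedCells_staircase.1 h).2, hg]

/-- Tableaux of unshifted shape `lam` in the marked alphabet. -/
def markedTableaux (lam : YoungDiagram) : Set (Filling Marked) :=
  {T | IsSetValued lam.cells (⊥ : YoungDiagram).cells T ∧
    (∀ i j, ∀ a ∈ T (i, j) ∩ T (i, j + 1), a.IsInteger) ∧
    (∀ i j, ∀ a ∈ T (i, j) ∩ T (i + 1, j), ¬ a.IsInteger)}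

theorem shiftFilling_eq_of_mem {lam : YoungDiagram} {T : Filling Marked}
    (hT : T ∈ ShSVTQSlash (addStaircase lam) (staircase (numParts lam))) :
    shiftFilling (numParts lam) (fun p => T (shiftRight (numParts lam) p)) = T := by
  funext ⟨i, k⟩
  by_cases h : numParts lam ≤ k
  · simp [shiftFilling, shiftRight, h]
  · rw [shiftFilling_of_lt _ (not_le.1 h)]
    by_cases h' : (i, k) ∈ shiftedCells (staircase (numParts lam))
    · rw [hT.2 _ h']
    · refine (hT.1.1.empty_outside _ fun h2 => ?_).symm
      rcases mem_shiftedCells_addStaircase.1 (Finset.mem_sdiff.1 h2).1 with h3 | h3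
      exacts [h' h3, h h3.1]

theorem unshift_mem {lam : YoungDiagram} {T : Filling Marked}
    (hT : T ∈ ShSVTQSlash (addStaircase lam) (staircase (numParts lam))) :
    (fun p => T (shiftRight (numParts lam) p)) ∈ markedTableaux lam := by
  have hadd : ∀ i j, shiftRight (numParts lam) (i, j + 1) = (i, j + numParts lam + 1) := fun i j =>
    Prod.ext rfl (by simp [shiftRight]; omega)
  refine ⟨⟨fun p hp => ?_, fun p hp => hT.1.1.nonempty _ ?_, fun i j => ?_, fun i j => ?_⟩,
    fun i j => ?_, fun i j => ?_⟩
  · have hp : p ∉ lam := by simpa [interior] using hp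
    refine hT.1.1.empty_outside _ fun h => hp ?_
    rcases mem_shiftedCells_addStaircase.1 (Finset.mem_sdiff.1 h).1 with h3 | h3
    · have := (mem_shiftedCells_staircase.1 h3).2; omega
    · simpa using h3.2
  · have hp : p ∈ lam := (Finset.mem_sdiff.1 hp).1
    refine Finset.mem_sdiff.2 ⟨mem_shiftedCells_addStaircase.2 (Or.inr ⟨by simp, by simpa using hp⟩),
      fun h => ?_⟩
    have := (mem_shiftedCells_staircase.1 h).2; omega
  · have := hT.1.1.row_le i (j + numParts lam)
    rwa [← hadd] at this
  · exact hT.1.1.col_le i (j + numParts lam)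
  · have := hT.1.2.1 i (j + numParts lam)
    rwa [← hadd] at this
  · exact hT.1.2.2 i (j + numParts lam)

theorem shiftFilling_mem {lam : YoungDiagram} {T : Filling Marked} (hT : T ∈ markedTableaux lam) :
    shiftFilling (numParts lam) T ∈ ShSVTQSlash (addStaircase lam) (staircase (numParts lam)) := by
  set n := numParts lam with hn
  have h0 : ∀ i k, k < n → shiftFilling n T (i, k) = ∅ := fun i k hk => shiftFilling_of_lt T hk
  have h1 : ∀ i j, shiftFilling n T (i, j + n) = T (i, j) := fun i j => shiftFilling_shiftRight n T (i, j)
  have h2 : ∀ k, k < n ∨ ∃ j, k = j + n := fun k =>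
    (lt_or_ge k n).imp_right fun h => ⟨k - n, by omega⟩
  have hstair : ∀ i k, (i, k) ∈ shiftedCells (staircase n) → shiftFilling n T (i, k) = ∅ :=
    fun i k h => h0 i k (mem_shiftedCells_staircase.1 h).2
  have hright : ∀ i j, shiftFilling n T (i, j + n + 1) = T (i, j + 1) := fun i j => by
    rw [show j + n + 1 = j + 1 + n by omega, h1]
  refine ⟨⟨⟨?_, ?_, ?_, ?_⟩, ?_, ?_⟩, fun p hp => hstair p.1 p.2 hp⟩
  · rintro ⟨i, k⟩ hp
    rcases h2 k with h | ⟨j, rfl⟩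
    · exact h0 i k h
    · rw [h1]
      refine hT.1.empty_outside _ fun h => hp (Finset.mem_sdiff.2 ⟨?_, fun h' => ?_⟩)
      · exact mem_shiftedCells_addStaircase.2 (Or.inr ⟨Nat.le_add_left _ _, by
          simpa [← hn] using (Finset.mem_sdiff.1 h).1⟩)
      · have := (mem_shiftedCells_staircase.1 (Finset.mem_filter.1 h').1).2
        omega
  · rintro ⟨i, k⟩ hp
    obtain ⟨h3, h4⟩ := Finset.mem_sdiff.1 hp
    obtain ⟨h5, h6⟩ := (mem_shiftedCells_addStaircase.1 h3).resolve_left h4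
    rw [shiftFilling, if_pos h5]
    exact hT.1.nonempty _ (by simpa using h6)
  · intro i k
    rcases h2 k with h | ⟨j, rfl⟩
    · rw [h0 i k h]; simp [SetLE]
    · rw [h1, hright]; exact hT.1.row_le i j
  · intro i k
    rcases h2 k with h | ⟨j, rfl⟩
    · rw [h0 i k h]; simp [SetLE]
    · rw [h1, h1]; exact hT.1.col_le i j
  · intro i k
    rcases h2 k with h | ⟨j, rfl⟩
    · rw [h0 i k h]; simp
    · rw [h1, hright]; exact hT.2.1 i j
  · intro i k
    rcases h2 k with h | ⟨j, rfl⟩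
    · rw [h0 i k h]; simp
    · rw [h1, h1]; exact hT.2.2 i j

theorem stairGQ_eq (β : ℝ) (lam : YoungDiagram) : stairGQ β lam =
    tableauSeries Marked.ceil β lam.cells (lam.card - (⊥ : YoungDiagram).card) (markedTableaux lam) := by
  funext m
  have hw : ∀ T : Filling Marked, weight Marked.ceil (shiftedCells (addStaircase lam))
      (shiftFilling (numParts lam) T) = weight Marked.ceil lam.cells T := fun T =>
    sum_shiftFilling (fun A : Finset Marked => ∑ a ∈ A, Finsupp.single (Marked.ceil a) 1)
      Finset.sum_empty lam T
  have hs : ∀ T : Filling Marked, size (shiftedCells (addStaircase lam))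
      (shiftFilling (numParts lam) T) = size lam.cells T := fun T =>
    sum_shiftFilling Finset.card Finset.card_empty lam T
  change ∑ᶠ T ∈ {T | T ∈ ShSVTQSlash (addStaircase lam) (staircase (numParts lam)) ∧
      weight Marked.ceil (shiftedCells (addStaircase lam)) T = m},
      β ^ (size (shiftedCells (addStaircase lam)) T -
        ((addStaircase lam).card - (staircase (numParts lam)).card)) =
    ∑ᶠ T ∈ {T | T ∈ markedTableaux lam ∧ weight Marked.ceil lam.cells T = m},
      β ^ (size lam.cells T - (lam.card - (⊥ : YoungDiagram).card))
  symm
  refine finsum_mem_eq_of_bijOn (shiftFilling (numParts lam)) ⟨?_, ?_, ?_⟩ fun T _ => ?_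
  · rintro T ⟨h1, h2⟩
    exact ⟨shiftFilling_mem h1, (hw T).trans h2⟩
  · intro T _ U _ h
    funext p
    rw [← shiftFilling_shiftRight (numParts lam) T, h, shiftFilling_shiftRight]
  · rintro T ⟨h1, h2⟩
    have h3 := shiftFilling_eq_of_mem h1
    exact ⟨_, ⟨unshift_mem h1, by rw [← hw, h3, h2]⟩, h3⟩
  · rw [hs, card_addStaircase]

/-! ### Invariance under transposition -/

theorem contentList_succ_last (c : ℤ) (n : ℕ) :
    contentList c (n + 1) = contentList c n ++ [c + n] := by
  induction n generalizing c with
  | zero => simp [contentList]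
  | succ n ih =>
    rw [contentList, ih (c + 1), contentList]
    simp only [List.cons_append, Nat.cast_add, Nat.cast_one]
    rw [show c + 1 + (n : ℤ) = c + (n + 1) by ring]

theorem map_neg_contentList (c : ℤ) (n : ℕ) :
    (contentList c n).map Neg.neg = (contentList (1 - c - n) n).reverse := by
  induction n generalizing c with
  | zero => rfl
  | succ n ih =>
    rw [contentList_succ_last (1 - c - (n + 1 : ℕ)), contentList, List.map_cons, ih,
      List.reverse_append, List.reverse_singleton, List.singleton_append]
    congr 1
    · push_cast; ring
    · congr 2; push_cast; ring

open Classical in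
theorem stepsOp_map_neg_steps {α : Type} {R : Type*} [CommRing R] (b : R) (x : α → R) (r : α → Prop)
    (N : ℕ) (l : List α) :
    stepsOp b x ((steps r N l).map fun s => (s.1, -s.2)) = (l.map fun a =>
      if r a then ascProd (boxOp b) (-N) (2 * N + 1) (x a)
      else descProd (boxOp b) (-N) (2 * N + 1) (x a)).prod := by
  have hneg : (contentList (-N) (2 * N + 1)).map Neg.neg = (contentList (-N) (2 * N + 1)).reverse := by
    rw [map_neg_contentList]
    congr 2; push_cast; ring
  have hneg' : (contentList (-N) (2 * N + 1)).reverse.map Neg.neg = contentList (-N) (2 * N + 1) := by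
    rw [List.map_reverse, hneg, List.reverse_reverse]
  induction l with
  | nil => rfl
  | cons a l ih =>
    rw [List.map_cons, List.prod_cons, ← ih]
    simp only [stepsOp, steps, List.flatMap_cons, List.map_append, List.prod_append]
    congr 1
    split_ifs
    · conv_rhs => rw [ascProd, ← hneg']
      simp [Function.comp_def]
    · conv_rhs => rw [descProd, ← hneg]
      simp [Function.comp_def]

/-- The marked letters `M, M', …, 2, 2', 1, 1'`. -/
def markedList (M : ℕ) : List Marked :=
  (letterList M).flatMap fun n => [toLex (n, true), toLex (n, false)]

theorem mem_markedList {M : ℕ} {a : Marked} (h : (a.ceil : ℕ) ≤ M) : a ∈ markedList M := by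
  refine List.mem_flatMap.2 ⟨a.ceil, mem_letterList.2 h, ?_⟩
  have e : a = toLex (a.ceil, (ofLex a).2) := rfl
  rcases hb : (ofLex a).2 with _ | _
  · rw [hb] at e; rw [List.mem_cons, List.mem_singleton]; exact Or.inr e
  · rw [hb] at e; rw [List.mem_cons]; exact Or.inl e

theorem pairwise_markedList (M : ℕ) : (markedList M).Pairwise (· > ·) := by
  rw [markedList, List.pairwise_flatMap]
  refine ⟨fun n _ => ?_, (pairwise_letterList M).imp fun {k n} h => ?_⟩
  · rw [List.pairwise_pair]
    exact Prod.Lex.toLex_lt_toLex.2 (Or.inr ⟨rfl, (by decide : false < true)⟩)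
  · intro s hs t ht
    simp only [List.mem_cons, List.not_mem_nil, or_false] at hs ht
    rcases hs with rfl | rfl <;> rcases ht with rfl | rfl <;>
    exact Prod.Lex.toLex_lt_toLex.2 (Or.inl h)

theorem coeff_stairGQ (β : ℝ) (lam : YoungDiagram) (m : ℕ+ →₀ ℕ) (N : ℕ)
    (hN : ∀ p ∈ lam, -(N : ℤ) ≤ content p ∧ content p ≤ N) :
    MvPowerSeries.coeff m (stairGQ β lam) =
      MvPowerSeries.coeff m (stepsOp (algebraMap ℝ (MvPowerSeries ℕ+ ℝ) β)
        (fun a => MvPowerSeries.X (Marked.ceil a)) (steps Marked.IsInteger N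
          (markedList (letterBound m))) (delta _ ⊥) lam) := by
  rw [coeff_stepsOp β Marked.ceil (pairwise_steps _ N (pairwise_markedList _)) lam ⊥ m
    (markedTableaux lam), stairGQ_eq]
  · rfl
  · intro T hw
    constructor
    · rintro ⟨h1, h2, h3⟩
      refine ⟨bot_le, h1, fun i j a ha ha' => h2 i j a (Finset.mem_inter.2 ⟨ha, ha'⟩),
        fun i j a ha ha' => h3 i j a (Finset.mem_inter.2 ⟨ha, ha'⟩), fun p a ha => ?_⟩
      have hp : p ∈ lam.cells \ interior (⊥ : YoungDiagram).cells := by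
        by_contra h
        simp [h1.empty_outside p h] at ha
      have hp := (Finset.mem_sdiff.1 hp).1
      exact mem_steps.2 ⟨mem_markedList (le_letterBound (mem_support_of_weight_eq hw hp ha)), hN p hp⟩
    · intro hT
      exact ⟨hT.isSetValued,
        fun i j a ha => hT.row i j a (Finset.mem_inter.1 ha).1 (Finset.mem_inter.1 ha).2,
        fun i j a ha => hT.col i j a (Finset.mem_inter.1 ha).1 (Finset.mem_inter.1 ha).2⟩

theorem prod_map_flatMap_congr {α A B : Type*} [Monoid B] (l : List α) (f : α → List A) (F F' : A → B)
    (h : ∀ a ∈ l, ((f a).map F).prod = ((f a).map F').prod) :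
    ((l.flatMap f).map F).prod = ((l.flatMap f).map F').prod := by
  induction l with
  | nil => rfl
  | cons a l ih =>
    simp only [List.flatMap_cons, List.map_append, List.prod_append]
    rw [h a List.mem_cons_self, ih fun a ha => h a (List.mem_cons_of_mem _ ha)]

/-- Transposition exchanges the roles of `i` and `i'`, that is, it reverses the order of the two
commuting operators which belong to the variable `x_i`. -/
theorem stairGQ_transpose (β : ℝ) (lam : YoungDiagram) :
    stairGQ β lam.transpose = stairGQ β lam := by
  classical
  ext m
  have hN := fun (p : ℕ × ℕ) (hp : p ∈ lam) => abs_content_le hp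
  have hN' : ∀ p ∈ lam.transpose, -(coordBound lam : ℤ) ≤ content p ∧ content p ≤ coordBound lam := by
    intro p hp
    have h := hN _ (YoungDiagram.mem_transpose.1 hp)
    rw [content_swap] at h
    omega
  rw [coeff_stairGQ β _ m _ hN, coeff_stairGQ β _ m _ hN', stepsOp_transpose, stepsOp_map_neg_steps,
    stepsOp_steps]
  have hd : (fun nu : YoungDiagram => delta (MvPowerSeries ℕ+ ℝ) ⊥ nu.transpose) = delta _ ⊥ := by
    funext nu
    have h0 : (⊥ : YoungDiagram).transpose = ⊥ := by
      ext p; simp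
    simp only [delta, YoungDiagram.transpose_eq_iff_eq_transpose, h0]
  rw [hd]
  refine congrArg (fun P : Module.End (MvPowerSeries ℕ+ ℝ) (YoungDiagram → MvPowerSeries ℕ+ ℝ) =>
    MvPowerSeries.coeff m (P (delta _ ⊥) lam)) (prod_map_flatMap_congr _ _ _ _ fun n _ => ?_)
  have h1 : Marked.IsInteger (toLex (n, true)) := rfl
  have h2 : ¬ Marked.IsInteger (toLex (n, false)) := Bool.false_ne_true
  simp only [List.map_cons, List.map_nil, List.prod_cons, List.prod_nil, mul_one, if_pos h1, if_neg h2]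
  obtain ⟨x', hx'⟩ := exists_formal_neg_X (S := ℝ) β n
  exact (isHeckeFamily_boxOp.commute_ascProd_descProd hx' _ _ _).eq

/-! ### Inclusion–exclusion over the corners of shifted diagrams -/

/-- Strict partitions are the ones whose shifted diagrams are closed under moving up within the
shifted quadrant. -/
theorem isStrict_iff {lam : YoungDiagram} :
    IsStrict lam ↔ ∀ i j, (i + 1, j) ∈ lam → (i, j + 1) ∈ lam := by
  simp only [IsStrict, YoungDiagram.mem_iff_lt_rowLen]
  constructor
  · intro h i j hj
    have h1 := lam.rowLen_anti i (i + 1) (Nat.le_succ i)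
    have h2 := h i (by omega)
    omega
  · intro h i hi
    by_contra hlt
    have := h i (lam.rowLen i - 1) (by omega)
    omega

theorem isStrict_staircase (n : ℕ) : IsStrict (staircase n) :=
  isStrict_iff.2 fun i j h => by rw [mem_staircase] at h ⊢; omega

theorem isStrict_addStaircase (lam : YoungDiagram) : IsStrict (addStaircase lam) :=
  isStrict_iff.2 fun i j h => by
    rw [mem_addStaircase] at h ⊢
    have := lam.rowLen_anti i (i + 1) (Nat.le_succ i)
    omega

theorem staircase_le_addStaircase (lam : YoungDiagram) :
    staircase (numParts lam) ≤ addStaircase lam := by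
  rintro ⟨i, j⟩ h
  have h : (i, j) ∈ staircase (numParts lam) := h
  change (i, j) ∈ addStaircase lam
  rw [mem_staircase] at h
  rw [mem_addStaircase]
  omega

theorem le_of_shiftedCells_subset {lam mu : YoungDiagram} (h : shiftedCells mu ⊆ shiftedCells lam) :
    mu ≤ lam := by
  rintro ⟨i, j⟩ hp
  have := h (mem_shiftedCells.2 ⟨Nat.le_add_right i j, by simpa using hp⟩)
  simpa using (mem_shiftedCells.1 this).2

theorem shiftedCells_mono {lam mu : YoungDiagram} (h : mu ≤ lam) :
    shiftedCells mu ⊆ shiftedCells lam :=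
  Finset.image_subset_image (YoungDiagram.cells_subset_iff.2 h)

/-- Removing corners from the shifted diagram of a strict partition leaves the shifted diagram of a
strict partition. -/
theorem exists_shiftedCells_eq_sdiff {mu : YoungDiagram} (hmu : IsStrict mu) {C : Finset (ℕ × ℕ)}
    (hC : C ⊆ shiftedCells mu \ interior (shiftedCells mu)) :
    ∃ kap, IsStrict kap ∧ shiftedCells kap = shiftedCells mu \ C := by
  rw [isStrict_iff] at hmu
  have hcorner : ∀ i j, (i, i + j) ∈ C → (i + 1, i + j) ∉ shiftedCells mu ∧ (i, j + 1) ∉ mu := by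
    intro i j h
    obtain ⟨h1, h2⟩ := Finset.mem_sdiff.1 (hC h)
    rw [interior, Finset.mem_filter, not_and, not_or] at h2
    refine ⟨(h2 h1).1, fun h3 => (h2 h1).2 (mem_shiftedCells.2 ⟨by dsimp; omega, ?_⟩)⟩
    simpa [show i + j + 1 - i = j + 1 by omega] using h3
  let kap : YoungDiagram :=
    { cells := mu.cells.filter fun p => (p.1, p.1 + p.2) ∉ C
      isLowerSet := by
        rintro ⟨i, j⟩ ⟨i', j'⟩ hle h
        obtain ⟨h1, h2⟩ := Prod.mk_le_mk.1 hle
        simp only [Finset.coe_filter, Set.mem_ofPred_eq, YoungDiagram.mem_cells] at h ⊢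
        refine ⟨mem_of_le h.1 h1 h2, fun h3 => ?_⟩
        have h4 := (hcorner i' j' h3).2
        rcases h2.lt_or_eq with h5 | rfl
        · exact h4 (mem_of_le h.1 h1 h5)
        · rcases h1.lt_or_eq with h5 | rfl
          · exact h4 (hmu i' j' (mem_of_le h.1 h5 le_rfl))
          · exact h.2 h3 }
  have hk : ∀ i j, (i, j) ∈ kap ↔ (i, j) ∈ mu ∧ (i, i + j) ∉ C := fun i j => Finset.mem_filter
  refine ⟨kap, isStrict_iff.2 fun i j h => ?_, ?_⟩
  · rw [hk] at h ⊢
    refine ⟨hmu i j h.1, fun h1 => ?_⟩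
    refine (hcorner i (j + 1) h1).1 (mem_shiftedCells.2 ⟨by omega, ?_⟩)
    rw [show i + (j + 1) - (i + 1) = j by omega]
    exact h.1
  · ext ⟨i, k⟩
    rw [mem_shiftedCells, hk, Finset.mem_sdiff, mem_shiftedCells, and_assoc]
    refine and_congr_right fun h => ?_
    rw [show i + (k - i) = k by omega]

theorem finite_ceil_preimage (n : ℕ+) : (Marked.ceil ⁻¹' {n}).Finite := by
  refine (Set.toFinite {toLex (n, true), toLex (n, false)}).subset fun a ha => ?_
  have e : a = toLex (Marked.ceil a, (ofLex a).2) := rfl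
  have ha : Marked.ceil a = n := ha
  rw [ha] at e
  rcases hb : (ofLex a).2 with _ | _
  · rw [hb] at e; exact Or.inr e
  · rw [hb] at e; exact Or.inl e

/-- The tableaux of shape `lam // mu` which are nonempty precisely at the set `C` of boxes of `mu`
are those of shape `lam / kap`, where `kap` is `mu` without `C`. -/
theorem mem_ShSVTQSlash_iff {lam mu kap : YoungDiagram} {C : Finset (ℕ × ℕ)}
    (hC : C ⊆ shiftedCells mu \ interior (shiftedCells mu))
    (hk : shiftedCells kap = shiftedCells mu \ C) (hle : mu ≤ lam) (T : Filling Marked) :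
    T ∈ ShSVTQSlash lam kap ↔
      T ∈ ShSVTQ lam mu ∧ ∀ p ∈ shiftedCells mu, (T p).Nonempty ↔ p ∈ C := by
  constructor
  · rintro ⟨⟨h1, h2, h3⟩, h4⟩
    have h5 : ∀ p ∈ shiftedCells mu, p ∉ C → T p = ∅ := fun p hp hpC =>
      h4 p (by rw [hk]; exact Finset.mem_sdiff.2 ⟨hp, hpC⟩)
    refine ⟨⟨⟨fun p hp => ?_, fun p hp => h1.nonempty p ?_, h1.row_le, h1.col_le⟩, h2, h3⟩,
      fun p hp => ⟨fun h => ?_, fun h => h1.nonempty p ?_⟩⟩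
    · by_cases hpl : p ∈ shiftedCells lam
      · have hpi : p ∈ interior (shiftedCells mu) := by
          by_contra h; exact hp (Finset.mem_sdiff.2 ⟨hpl, h⟩)
        exact h5 p (Finset.mem_filter.1 hpi).1 fun h => (Finset.mem_sdiff.1 (hC h)).2 hpi
      · exact h1.empty_outside p fun h => hpl (Finset.mem_sdiff.1 h).1
    · rw [hk, Finset.mem_sdiff, Finset.mem_sdiff]
      exact ⟨(Finset.mem_sdiff.1 hp).1, fun h => (Finset.mem_sdiff.1 hp).2 h.1⟩
    · by_contra hpC
      simp [h5 p hp hpC] at h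
    · rw [hk, Finset.mem_sdiff, Finset.mem_sdiff]
      exact ⟨shiftedCells_mono hle hp, fun h' => h'.2 h⟩
  · rintro ⟨⟨h1, h2, h3⟩, h4⟩
    have h5 : ∀ p ∈ shiftedCells kap, T p = ∅ := by
      intro p hp
      rw [hk, Finset.mem_sdiff] at hp
      rw [← Finset.not_nonempty_iff_eq_empty, h4 p hp.1]
      exact hp.2
    refine ⟨⟨⟨fun p hp => ?_, fun p hp => ?_, h1.row_le, h1.col_le⟩, h2, h3⟩, h5⟩
    · by_cases hpl : p ∈ shiftedCells lam
      · have hpi : p ∈ interior (shiftedCells kap) := by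
          by_contra h; exact hp (Finset.mem_sdiff.2 ⟨hpl, h⟩)
        exact h5 p (Finset.mem_filter.1 hpi).1
      · exact h1.empty_outside p fun h => hpl (Finset.mem_sdiff.1 h).1
    · rw [hk, Finset.mem_sdiff, Finset.mem_sdiff] at hp
      by_cases hpm : p ∈ shiftedCells mu
      · exact (h4 p hpm).2 (by by_contra h; exact hp.2 ⟨hpm, h⟩)
      · exact h1.nonempty p (Finset.mem_sdiff.2 ⟨hp.1, hpm⟩)

/-- Sorting the tableaux of shape `lam // mu` by the set of boxes of `mu` which they occupy. -/
theorem skewGQ_eq_sum (β : ℝ) {lam mu : YoungDiagram} (hle : mu ≤ lam)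
    (kap : Finset (ℕ × ℕ) → YoungDiagram)
    (hk : ∀ C ⊆ shiftedCells mu \ interior (shiftedCells mu),
      shiftedCells (kap C) = shiftedCells mu \ C) :
    skewGQ β lam mu = ∑ C ∈ (shiftedCells mu \ interior (shiftedCells mu)).powerset,
      β ^ C.card • slashGQ β lam (kap C) := by
  ext m
  rw [map_sum]
  set A : Finset (ℕ × ℕ) → Set (Filling Marked) := fun C =>
    {T | T ∈ ShSVTQSlash lam (kap C) ∧ weight Marked.ceil (shiftedCells lam) T = m} with hA
  have hf : ∀ C, (A C).Finite := fun C =>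
    (finite_weight_eq Marked.ceil finite_ceil_preimage (shiftedCells lam) (shiftedCells (kap C))
      m).subset fun T hT => ⟨hT.1.1.1, hT.2⟩
  have e : {T | T ∈ ShSVTQ lam mu ∧ weight Marked.ceil (shiftedCells lam) T = m} =
      ⋃ C ∈ ((shiftedCells mu \ interior (shiftedCells mu)).powerset : Set (Finset (ℕ × ℕ))), A C := by
    ext T
    simp only [Set.mem_iUnion, Finset.mem_coe, Finset.mem_powerset, exists_prop]
    constructor
    · rintro ⟨h1, h2⟩
      have hC : (shiftedCells mu).filter (fun p => (T p).Nonempty) ⊆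
          shiftedCells mu \ interior (shiftedCells mu) := by
        intro p hp
        obtain ⟨hp1, hp2⟩ := Finset.mem_filter.1 hp
        refine Finset.mem_sdiff.2 ⟨hp1, fun hp3 => ?_⟩
        rw [h1.1.empty_outside p fun h => (Finset.mem_sdiff.1 h).2 hp3] at hp2
        exact Finset.not_nonempty_empty hp2
      refine ⟨_, hC, (mem_ShSVTQSlash_iff hC (hk _ hC) hle T).2 ⟨h1, fun p hp => ?_⟩, h2⟩
      rw [Finset.mem_filter]
      tauto
    · rintro ⟨C, hC, h1, h2⟩
      exact ⟨((mem_ShSVTQSlash_iff hC (hk _ hC) hle T).1 h1).1, h2⟩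
  have hdisj : ((shiftedCells mu \ interior (shiftedCells mu)).powerset :
      Set (Finset (ℕ × ℕ))).PairwiseDisjoint A := by
    intro C hC C' hC' hne
    refine Set.disjoint_left.2 fun T hT hT' => hne ?_
    have hC := Finset.mem_powerset.1 hC
    have hC' := Finset.mem_powerset.1 hC'
    have h1 := ((mem_ShSVTQSlash_iff hC (hk _ hC) hle T).1 hT.1).2
    have h2 := ((mem_ShSVTQSlash_iff hC' (hk _ hC') hle T).1 hT'.1).2
    ext p
    constructor
    · intro hp
      have hp' := (Finset.mem_sdiff.1 (hC hp)).1
      exact (h2 p hp').1 ((h1 p hp').2 hp)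
    · intro hp
      have hp' := (Finset.mem_sdiff.1 (hC' hp)).1
      exact (h1 p hp').1 ((h2 p hp').2 hp)
  change ∑ᶠ T ∈ {T | T ∈ ShSVTQ lam mu ∧ weight Marked.ceil (shiftedCells lam) T = m},
    β ^ (size (shiftedCells lam) T - (lam.card - mu.card)) = _
  rw [e, finsum_mem_biUnion hdisj (Finset.finite_toSet _) fun C _ => hf C, finsum_mem_coe_finset]
  refine Finset.sum_congr rfl fun C hC => ?_
  have hC := Finset.mem_powerset.1 hC
  rw [map_smul, smul_eq_mul]
  change _ = β ^ C.card * ∑ᶠ T ∈ A C, β ^ (size (shiftedCells lam) T - (lam.card - (kap C).card))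
  rw [mul_finsum_mem' _ _ (hf C)]
  refine finsum_mem_congr rfl fun T hT => ?_
  have hsub : C ⊆ shiftedCells mu := hC.trans Finset.sdiff_subset
  have h1 : (kap C).card + C.card = mu.card := by
    rw [← card_shiftedCells, ← card_shiftedCells, hk C hC, Finset.card_sdiff_of_subset hsub]
    have := Finset.card_le_card hsub
    omega
  have h2 : mu.card ≤ lam.card := Finset.card_le_card (YoungDiagram.cells_subset_iff.2 hle)
  have h3 : lam.card - (kap C).card ≤ size (shiftedCells lam) T := by
    refine le_trans (le_of_eq ?_) (card_sub_le_size hT.1.1.1.nonempty)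
    rw [Finset.card_sdiff_of_subset, card_shiftedCells, card_shiftedCells]
    rw [hk C hC]
    exact Finset.sdiff_subset.trans (shiftedCells_mono hle)
  rw [← pow_add]
  congr 1
  omega

theorem slashGQ_mem_GammaQ (β : ℝ) {lam mu : YoungDiagram} (hlam : IsStrict lam) (hmu : IsStrict mu)
    (hle : mu ≤ lam) : slashGQ β lam mu ∈ GammaQ β := by
  induction hn : mu.card using Nat.strong_induction_on generalizing mu with
  | _ n ih =>
    have hex := fun (C : Finset (ℕ × ℕ)) (hC : C ⊆ shiftedCells mu \ interior (shiftedCells mu)) =>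
      exists_shiftedCells_eq_sdiff hmu hC
    choose! kap hstrict hk using hex
    have h0 : kap ∅ = mu := by
      have h := hk ∅ (Finset.empty_subset _)
      rw [Finset.sdiff_empty] at h
      exact le_antisymm (le_of_shiftedCells_subset h.le) (le_of_shiftedCells_subset h.ge)
    have key := skewGQ_eq_sum β hle kap hk
    rw [← Finset.add_sum_erase _ _ (Finset.empty_mem_powerset _), Finset.card_empty, pow_zero,
      one_smul, h0] at key
    rw [← sub_eq_iff_eq_add.2 key]
    refine Submodule.sub_mem _ (Submodule.subset_span ⟨lam, mu, hlam, hmu, hle, rfl⟩)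
      (Submodule.sum_mem _ fun C hC => Submodule.smul_mem _ _ ?_)
    obtain ⟨hC0, hC1⟩ := Finset.mem_erase.1 hC
    have hC1 := Finset.mem_powerset.1 hC1
    have hsub : C ⊆ shiftedCells mu := hC1.trans Finset.sdiff_subset
    refine ih _ ?_ (hstrict C hC1) ?_ rfl
    · rw [← hn, ← card_shiftedCells, ← card_shiftedCells mu, hk C hC1,
        Finset.card_sdiff_of_subset hsub]
      have := Finset.card_pos.2 (Finset.nonempty_iff_ne_empty.2 hC0)
      have := Finset.card_le_card hsub
      omega
    · refine (le_of_shiftedCells_subset ?_).trans hle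
      rw [hk C hC1]
      exact Finset.sdiff_subset

theorem stairGQ_mem_GammaQ (β : ℝ) (lam : YoungDiagram) : stairGQ β lam ∈ GammaQ β :=
  slashGQ_mem_GammaQ β (isStrict_addStaircase lam) (isStrict_staircase _)
    (staircase_le_addStaircase lam)

end KSym

theorem mainTheorem9 (β : ℝ) :
    (∃! Om : KSym.Gamma β →ₗ[ℝ] KSym.Gamma β, KSym.IsTransposeMap β Om) ∧
    (∃! Th : KSym.Gamma β →ₗ[ℝ] KSym.GammaQ β, KSym.IsThetaMap β Th) ∧
    ∀ (Om : KSym.Gamma β →ₗ[ℝ] KSym.Gamma β) (Th : KSym.Gamma β →ₗ[ℝ] KSym.GammaQ β),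
      KSym.IsTransposeMap β Om → KSym.IsThetaMap β Th → Th ∘ₗ Om = Th := by
  have hext : ∀ {V : Type} [AddCommGroup V] [Module ℝ V] (f g : KSym.Gamma β →ₗ[ℝ] V),
      (∀ lam, f (KSym.GElt β lam) = g (KSym.GElt β lam)) → f = g := by
    intro V _ _ f g h
    refine (KSym.basisG β).ext fun lam => ?_
    rw [KSym.basisG_apply, h]
  have hconstr : ∀ {V : Type} [AddCommGroup V] [Module ℝ V] (v : YoungDiagram → V) (lam),
      (KSym.basisG β).constr ℝ v (KSym.GElt β lam) = v lam := by
    intro V _ _ v lam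
    rw [← KSym.basisG_apply, Module.Basis.constr_basis]
  refine ⟨⟨(KSym.basisG β).constr ℝ fun lam => KSym.GElt β lam.transpose, fun lam => hconstr _ lam,
    fun f hf => hext _ _ fun lam => (hf lam).trans
      (hconstr (fun lam => KSym.GElt β lam.transpose) lam).symm⟩,
    ⟨(KSym.basisG β).constr ℝ fun lam => ⟨KSym.stairGQ β lam, KSym.stairGQ_mem_GammaQ β lam⟩,
      fun lam => congrArg Subtype.val (hconstr _ lam), fun f hf => hext _ _ fun lam => ?_⟩,
    fun Om Th hOm hTh => hext _ _ fun lam => ?_⟩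
  · rw [hconstr]
    exact Subtype.ext (hf lam)
  · rw [LinearMap.comp_apply, hOm lam]
    refine Subtype.ext ?_
    rw [hTh, hTh, KSym.stairGQ_transpose]
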